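/- Let $\mathrm{Out}$ be the category of finite groups and conjugacy classes of surjective homomorphisms (two homomorphisms being conjugate if they differ by an inner automorphism of the target), and let $\mathrm{Out}_{cyc}\subset\mathrm{Out}$ be the full subcategory on the groups $C_n\subset\mathbb C^\times$ of $n$-th roots of unity, $n\ge 1$. An $\mathrm{Out}^{op}$-module (resp. $\mathrm{Out}_{cyc}^{op}$-module) here means a contravariant functor from $\mathrm{Out}$ (resp. $\mathrm{Out}_{cyc}$) to $\mathbb Q$-vector spaces. For $n\mid m$ let $p_{m,n}:C_m\to C_n$, $x\mapsto x^{m/n}$, be the preferred projection, which sends $e^{2\pi i/m}$ to $e^{2\pi i/n}$. For a finite group $G$ let $\mathbf{RU}(G)$ be the complex representation ring, let $\mathbf{RU}_{\mathbb Q}(G)=\mathbb Q\otimes\mathbf{RU}(G)$, and let $$\tau(\mathbf{RU}_{\mathbb Q})(G)=\mathbf{RU}_{\mathbb Q}(G)\Big/\sum_{H<G}\mathrm{Ind}_H^G\,\mathbf{RU}_{\mathbb Q}(H),$$ the sum being over all proper subgroups $H$ of $G$. The submodule divided out is an ideal and is compatible with inflations, so that $\tau(\mathbf{RU}_{\mathbb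 Q})$ is an $\mathrm{Out}^{op}$-module, with values in commutative $\mathbb Q$-algebras; it is regarded as an $\mathrm{Out}_{cyc}^{op}$-module by restriction. Let $\mathbb Q[\mathrm{Out}(-)]$ be the $\mathrm{Out}_{cyc}^{op}$-module whose value at $C_n$ is the regular representation $\mathbb Q[\mathrm{Out}(C_n)]$, where $p_{m,n}^*$ sends a basis element $j\in\mathrm{Out}(C_n)$ to the sum of all $\tilde\jmath\in\mathrm{Out}(C_m)$ with $p_{m,n}\circ\tilde\jmath=j\circ p_{m,n}$. A morphism $\varphi:\mathbb Q[\mathrm{Out}(-)]\to\tau(\mathbf{RU}_{\mathbb Q})$ is classified by the elements $x_n=\varphi_{C_n}(1)\in\tau(\mathbf{RU}_{\mathbb Q})(C_n)$, the images of the identity elements $1\in\mathrm{Out}(C_n)$. **Proposition.** There is an isomorphism of $\mathrm{Out}_{cyc}^{op}$-modules $$\varphi:\mathbb Q[\mathrm{Out}(-)]\xrightarrow{\ \cong\ }\tau(\mathbf{RU}_{\mathbb Q})$$ whose classifying elements $x_n$ satisfy the following. 1. $x_1=1$. 2. For every prime $p$, every $k\ge 1$ and every primitive $p^k$-th root of unity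 $\zeta$ in the cyclotomic field $\mathbb Q(\zeta)$, there is an isomorphism of $\mathbb Q$-algebras $\tau(\mathbf{RU}_{\mathbb Q})(C_{p^k})\cong\mathbb Q(\zeta)$ that sends the class of the one-dimensional tautological representation of $C_{p^k}\subset\mathbb C^\times$ to $\zeta$, and that sends $x_{p^k}$ to $$-\frac{1}{p^{k-1}}\left(\zeta+\zeta^{p}+\zeta^{p^2}+\cdots+\zeta^{p^{k-1}}\right).$$ 3. For coprime $m,n\ge 1$, $x_{mn}=p_{mn,m}^*(x_m)\cdot p_{mn,n}^*(x_n)$ in the ring $\tau(\mathbf{RU}_{\mathbb Q})(C_{mn})$. -/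

import Mathlib

open CategoryTheory TensorProduct

noncomputable section

namespace GlobalRU

/-! ## Induced representations -/

section Ind

variable {G K : Type} [Group G] [Group K] (φ : K →* G)
  {A B C : Type} [AddCommGroup A] [Module ℂ A] [AddCommGroup B] [Module ℂ B]
  [AddCommGroup C] [Module ℂ C]
  (ρ : Representation ℂ K A) (σ : Representation ℂ K B) (θ : Representation ℂ G C)

/-- The class of `g ⊗ a` in the underlying space `ℂ[G] ⊗_K A` of the induced representation. -/
def indMk (g : G) : A →ₗ[ℂ] Representation.IndV φ ρ := Representation.IndV.mk φ ρ g

variable {φ ρ} in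
theorem indMk_ext {f f' : Representation.IndV φ ρ →ₗ[ℂ] C}
    (h : ∀ g a, f (indMk φ ρ g a) = f' (indMk φ ρ g a)) : f = f' :=
  Representation.IndV.hom_ext φ ρ (fun g => LinearMap.ext (h g))

/-- The universal property of `ℂ[G] ⊗_K A` as a vector space. -/
def indLift (f : G → A →ₗ[ℂ] B) (hf : ∀ (k : K) (g : G) (a : A), f (φ k * g) (ρ k a) = f g a) :
    Representation.IndV φ ρ →ₗ[ℂ] B :=
  Representation.Coinvariants.lift _
    (TensorProduct.lift ((Finsupp.lift _ _ _ f) ∘ₗ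
      (MonoidAlgebra.coeffLinearEquiv ℂ).toLinearMap))
    (fun k => by
      ext g a
      simp [hf])

@[simp]
theorem indLift_mk (f : G → A →ₗ[ℂ] B)
    (hf : ∀ (k : K) (g : G) (a : A), f (φ k * g) (ρ k a) = f g a) (g : G) (a : A) :
    indLift φ ρ f hf (indMk φ ρ g a) = f g a := by
  simp [indLift, indMk]

@[simp]
theorem indMk_mul (k : K) (g : G) (a : A) :
    indMk φ ρ (φ k * g) (ρ k a) = indMk φ ρ g a := by
  have := Representation.Coinvariants.mk_self_apply
    (ρ := Representation.tprod ((Representation.leftRegular ℂ G).comp φ) ρ) k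
    ((MonoidAlgebra.single g (1 : ℂ)) ⊗ₜ a)
  simpa [indMk] using this

@[simp]
theorem ind_indMk (h g : G) (a : A) :
    Representation.ind φ ρ h (indMk φ ρ g a) = indMk φ ρ (g * h⁻¹) a :=
  Representation.ind_mk φ ρ h g a

variable {ρ σ} in
/-- Isomorphic representations have isomorphic inductions. -/
def indCongr (e : ρ.Equiv σ) : (Representation.ind φ ρ).Equiv (Representation.ind φ σ) :=
  .mk (.ofLinearMap
      (indLift φ ρ (fun g => indMk φ σ g ∘ₗ e.toLinearMap) (fun k g a => by
        have := e.toIntertwiningMap.isIntertwining _ _ k a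
        simp_all))
      (indLift φ σ (fun g => indMk φ ρ g ∘ₗ e.symm.toLinearMap) (fun k g a => by
        have := e.symm.toIntertwiningMap.isIntertwining _ _ k a
        simp_all))
      (indMk_ext fun g a => by simp)
      (indMk_ext fun g a => by simp))
    (fun g => indMk_ext fun x a => by simp [-Representation.ind_apply])

/-- Induction commutes with direct sums. -/
def indProd : (Representation.ind φ (ρ.prod σ)).Equiv
    ((Representation.ind φ ρ).prod (Representation.ind φ σ)) :=
  .mk (.ofLinearMap
      (indLift φ (ρ.prod σ)
        (fun g => LinearMap.prod (indMk φ ρ g ∘ₗ LinearMap.fst ℂ A B)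
          (indMk φ σ g ∘ₗ LinearMap.snd ℂ A B)) (fun k g a => by simp))
      (LinearMap.coprod
        (indLift φ ρ (fun g => indMk φ (ρ.prod σ) g ∘ₗ LinearMap.inl ℂ A B) (fun k g a => by
          have := indMk_mul φ (ρ.prod σ) k g (a, 0)
          simpa using this))
        (indLift φ σ (fun g => indMk φ (ρ.prod σ) g ∘ₗ LinearMap.inr ℂ A B) (fun k g a => by
          have := indMk_mul φ (ρ.prod σ) k g (0, a)
          simpa using this)))
      (LinearMap.prod_ext (indMk_ext fun g a => by simp) (indMk_ext fun g a => by simp))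
      (indMk_ext fun g a => by simp [← map_add]))
    (fun g => indMk_ext fun x a => by simp [-Representation.ind_apply])

/-- Frobenius reciprocity for modules: `Ind (A ⊗ Res C) ≅ Ind A ⊗ C`. -/
def indTensor : (Representation.ind φ (ρ.tprod (θ.comp φ))).Equiv
    ((Representation.ind φ ρ).tprod θ) :=
  .mk (.ofLinearMap
      (indLift φ (ρ.tprod (θ.comp φ))
        (fun g => TensorProduct.map (indMk φ ρ g) (θ g⁻¹)) (fun k g a => by
          induction a using TensorProduct.induction_on with
          | zero => simp
          | add x y hx hy => simp only [map_add, hx, hy]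
          | tmul a c => simp [← Module.End.mul_apply, ← map_mul]))
      (TensorProduct.lift (indLift φ ρ
        (fun g => LinearMap.mk₂ ℂ (fun a c => indMk φ (ρ.tprod (θ.comp φ)) g (a ⊗ₜ θ g c))
          (by intros; simp [TensorProduct.add_tmul]) (by intros; simp [← TensorProduct.smul_tmul'])
          (by intros; simp [TensorProduct.tmul_add]) (by intros; simp))
        (fun k g a => by
          ext c
          have := indMk_mul φ (ρ.tprod (θ.comp φ)) k g (a ⊗ₜ θ g c)
          simpa using this)))
      (TensorProduct.ext (indMk_ext fun g a => by ext c; simp))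
      (indMk_ext fun g a => by
        induction a using TensorProduct.induction_on with
        | zero => simp
        | add x y hx hy => simp only [map_add, hx, hy]
        | tmul a c => simp))
    (fun g => indMk_ext fun x a => by
        induction a using TensorProduct.induction_on with
        | zero => simp
        | add x y hx hy => simp only [map_add, hx, hy]
        | tmul a c => simp [-Representation.ind_apply])

end Ind

section BaseChange

variable {G K : Type} [Group G] [Group K] (α : K →* G) (hα : Function.Surjective α)
  (H : Subgroup G) {A : Type} [AddCommGroup A] [Module ℂ A] (ρ : Representation ℂ H A)

/-- The restriction `α⁻¹(H) → H` of a homomorphism `α`. -/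
def comapHom : H.comap α →* H := (α.comp (H.comap α).subtype).codRestrict H (fun x => x.2)

@[simp]
theorem coe_comapHom (x : H.comap α) : (comapHom α H x : G) = α x := rfl

/-- For `α : K → G` surjective, `α^* Ind_H^G A ≅ Ind_{α⁻¹ H}^K α^* A`. -/
def indComap : (Representation.ind (H.comap α).subtype (ρ.comp (comapHom α H))).Equiv
    ((Representation.ind H.subtype ρ).comp α) :=
  .mk (.ofLinearMap
      (indLift _ _ (fun k => indMk H.subtype ρ (α k)) (fun k g a => by
        have := indMk_mul H.subtype ρ (comapHom α H k) (α g) a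
        simpa using this))
      (indLift _ _ (fun g => indMk (H.comap α).subtype (ρ.comp (comapHom α H))
          (Function.surjInv hα g)) (fun h g a => by
        have hm : Function.surjInv hα (h * g) * (Function.surjInv hα g)⁻¹ ∈ H.comap α := by
          simp [Function.surjInv_eq]
        have := indMk_mul (H.comap α).subtype (ρ.comp (comapHom α H)) ⟨_, hm⟩
          (Function.surjInv hα g) a
        have e : comapHom α H ⟨_, hm⟩ = h := by
          ext; simp [Function.surjInv_eq]
        simpa [e] using this))
      (indMk_ext fun g a => by simp [Function.surjInv_eq])
      (indMk_ext fun k a => by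
        have hm : Function.surjInv hα (α k) * k⁻¹ ∈ H.comap α := by
          simp [Function.surjInv_eq]
        have := indMk_mul (H.comap α).subtype (ρ.comp (comapHom α H)) ⟨_, hm⟩ k a
        have e : comapHom α H ⟨_, hm⟩ = 1 := by
          ext; simp [Function.surjInv_eq]
        simpa [e] using this))
    (fun g => indMk_ext fun x a => by simp [-Representation.ind_apply])

end BaseChange

/-! ## The representation ring -/

/-- A finite-dimensional complex representation of `G`. -/
structure FinRep (G : Type) [Group G] where
  /-- The underlying vector space. -/
  V : Type
  [addCommGroup : AddCommGroup V]
  [module : Module ℂ V]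
  [finite : Module.Finite ℂ V]
  /-- The action. -/
  ρ : Representation ℂ G V

attribute [instance] FinRep.addCommGroup FinRep.module FinRep.finite

section RepRing

variable {G K L : Type} [Group G] [Group K] [Group L]

namespace FinRep

/-- Isomorphism of representations. -/
instance setoid (G : Type) [Group G] : Setoid (FinRep G) where
  r V W := Nonempty (V.ρ.Equiv W.ρ)
  iseqv := ⟨fun V => ⟨.refl V.ρ⟩, fun ⟨e⟩ => ⟨e.symm⟩, fun ⟨e⟩ ⟨f⟩ => ⟨e.trans f⟩⟩

/-- The trivial one-dimensional representation. -/
def one (G : Type) [Group G] : FinRep G := ⟨ℂ, Representation.trivial ℂ G ℂ⟩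

/-- Direct sum of representations. -/
def sum (V W : FinRep G) : FinRep G := ⟨V.V × W.V, V.ρ.prod W.ρ⟩

/-- Tensor product of representations. -/
def tensor (V W : FinRep G) : FinRep G := ⟨V.V ⊗[ℂ] W.V, V.ρ.tprod W.ρ⟩

/-- Restriction of representations along a homomorphism `α : K → G`. -/
def res (α : K →* G) (V : FinRep G) : FinRep K := ⟨V.V, V.ρ.comp α⟩

/-- Induction `ℂ[G] ⊗_{ℂ[H]} V` of representations from a subgroup `H` of a finite group `G`. -/
def ind [Finite G] (H : Subgroup G) (V : FinRep H) : FinRep G :=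
  have : Module.Finite ℂ (MonoidAlgebra ℂ G) := Module.Finite.of_basis (MonoidAlgebra.basis G ℂ)
  ⟨Representation.IndV H.subtype V.ρ, Representation.ind H.subtype V.ρ⟩

theorem sum_congr {V V' W W' : FinRep G} (h : V ≈ V') (h' : W ≈ W') :
    V.sum W ≈ V'.sum W' := by
  obtain ⟨e⟩ := h
  obtain ⟨f⟩ := h'
  refine ⟨.mk (e.toLinearEquiv.prodCongr f.toLinearEquiv) fun g => ?_⟩
  refine LinearMap.ext fun x => Prod.ext ?_ ?_
  · exact e.toIntertwiningMap.isIntertwining _ _ g x.1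
  · exact f.toIntertwiningMap.isIntertwining _ _ g x.2

theorem tensor_congr {V V' W W' : FinRep G} (h : V ≈ V') (h' : W ≈ W') :
    V.tensor W ≈ V'.tensor W' := by
  obtain ⟨e⟩ := h
  obtain ⟨f⟩ := h'
  refine ⟨.mk (TensorProduct.congr e.toLinearEquiv f.toLinearEquiv) fun g => ?_⟩
  refine TensorProduct.ext' fun x y => ?_
  exact congrArg₂ (· ⊗ₜ[ℂ] ·) (e.toIntertwiningMap.isIntertwining _ _ g x)
    (f.toIntertwiningMap.isIntertwining _ _ g y)

theorem res_congr (α : K →* G) {V V' : FinRep G} (h : V ≈ V') : V.res α ≈ V'.res α := by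
  obtain ⟨e⟩ := h
  exact ⟨.mk e.toLinearEquiv fun g => LinearMap.ext fun x =>
    e.toIntertwiningMap.isIntertwining _ _ (α g) x⟩

theorem tensor_sum (U V W : FinRep G) :
    U.tensor (V.sum W) ≈ (U.tensor V).sum (U.tensor W) := by
  refine ⟨.mk (TensorProduct.prodRight ℂ ℂ U.V V.V W.V) fun g => ?_⟩
  refine TensorProduct.ext' fun x y => ?_
  rfl

end FinRep

/-- Isomorphism classes of finite-dimensional complex representations of `G`. -/
def RepClass (G : Type) [Group G] : Type 1 := Quotient (FinRep.setoid G)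

namespace RepClass

/-- The isomorphism class of a representation. -/
def mk (V : FinRep G) : RepClass G := Quotient.mk _ V

theorem sound {V W : FinRep G} (h : V ≈ W) : mk V = mk W := Quotient.sound h

/-- Isomorphism classes form a commutative monoid under tensor product. -/
instance : CommMonoid (RepClass G) where
  mul := Quotient.map₂ FinRep.tensor fun _ _ h _ _ h' => FinRep.tensor_congr h h'
  one := mk (FinRep.one G)
  mul_assoc := by
    rintro ⟨U⟩ ⟨V⟩ ⟨W⟩
    exact sound ⟨Representation.TensorProduct.assoc _ _ _⟩
  one_mul := by
    rintro ⟨U⟩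
    exact sound ⟨Representation.TensorProduct.lid ℂ _⟩
  mul_one := by
    rintro ⟨U⟩
    exact sound ⟨Representation.TensorProduct.rid ℂ _⟩
  mul_comm := by
    rintro ⟨U⟩ ⟨V⟩
    exact sound ⟨Representation.TensorProduct.comm _ _⟩

theorem mk_mul_mk (V W : FinRep G) : mk V * mk W = mk (V.tensor W) := rfl

theorem one_def : (1 : RepClass G) = mk (FinRep.one G) := rfl

/-- Restriction of isomorphism classes. -/
def res (α : K →* G) : RepClass G →* RepClass K where
  toFun := Quotient.map (FinRep.res α) fun _ _ h => FinRep.res_congr α h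
  map_one' := rfl
  map_mul' := by
    rintro ⟨U⟩ ⟨V⟩
    rfl

theorem res_mk (α : K →* G) (V : FinRep G) : res α (mk V) = mk (V.res α) := rfl

/-- Induction of isomorphism classes. -/
def ind [Finite G] (H : Subgroup G) : RepClass H → RepClass G :=
  Quotient.map (FinRep.ind H) fun _ _ ⟨e⟩ => ⟨indCongr H.subtype e⟩

theorem ind_mk [Finite G] (H : Subgroup G) (V : FinRep H) : ind H (mk V) = mk (V.ind H) := rfl

end RepClass

/-- The ideal of relations `[V ⊕ W] = [V] + [W]`. -/
def sumIdeal (G : Type) [Group G] : Ideal (FreeAbelianGroup (RepClass G)) :=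
  Ideal.span {x | ∃ V W : FinRep G, x = .of (.mk (V.sum W)) - (.of (.mk V) + .of (.mk W))}

/-- The complex representation ring: the Grothendieck ring of finite-dimensional complex
representations, with addition the direct sum and multiplication the tensor product. -/
abbrev RU (G : Type) [Group G] : Type 1 := FreeAbelianGroup (RepClass G) ⧸ sumIdeal G

namespace RU

/-- The class of a representation in the representation ring. -/
def of (V : FinRep G) : RU G := Ideal.Quotient.mk _ (.of (.mk V))

theorem of_eq {V W : FinRep G} (h : V ≈ W) : of V = of W := by
  rw [of, of, RepClass.sound h]

theorem of_sum (V W : FinRep G) : of (V.sum W) = of V + of W := by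
  rw [of, of, of, ← map_add, Ideal.Quotient.eq]
  exact Ideal.subset_span ⟨V, W, rfl⟩

theorem of_tensor (V W : FinRep G) : of (V.tensor W) = of V * of W := by
  rw [of, of, of, ← map_mul, FreeAbelianGroup.of_mul_of, RepClass.mk_mul_mk]

@[elab_as_elim]
theorem induction {p : RU G → Prop} (x : RU G) (hof : ∀ V, p (of V))
    (hneg : ∀ x, p x → p (-x)) (hadd : ∀ x y, p x → p y → p (x + y)) : p x := by
  obtain ⟨x, rfl⟩ := Ideal.Quotient.mk_surjective x
  have hof' : ∀ y : RepClass G, p (Ideal.Quotient.mk (sumIdeal G) (.of y)) := by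
    rintro ⟨V⟩
    exact hof V
  induction x using FreeAbelianGroup.induction_on with
  | zero =>
    have := hadd _ _ (hof (FinRep.one G)) (hneg _ (hof (FinRep.one G)))
    simpa using this
  | of y => exact hof' y
  | neg y h => simpa using hneg _ h
  | add y z h h' => simpa using hadd _ _ h h'

/-- An invariant of representations that is additive on direct sums extends to the
representation ring. -/
def lift {A : Type*} [AddCommGroup A] (f : RepClass G → A)
    (hf : ∀ V W : FinRep G, f (.mk (V.sum W)) = f (.mk V) + f (.mk W)) : RU G →+ A :=
  QuotientAddGroup.lift (sumIdeal G).toAddSubgroup (FreeAbelianGroup.lift f) (by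
    intro x hx
    suffices h : ∀ r, FreeAbelianGroup.lift f (r * x) = 0 by simpa using h 1
    refine Submodule.span_induction (p := fun x _ => ∀ r, FreeAbelianGroup.lift f (r * x) = 0)
      ?_ ?_ ?_ ?_ hx
    · rintro _ ⟨V, W, rfl⟩ r
      induction r using FreeAbelianGroup.induction_on with
      | zero => simp
      | of U =>
        obtain ⟨U⟩ := U
        change FreeAbelianGroup.lift f (.of (RepClass.mk U) * _) = 0
        simp only [mul_sub, mul_add, FreeAbelianGroup.of_mul_of, RepClass.mk_mul_mk, map_sub,
          map_add, FreeAbelianGroup.lift_apply_of]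
        rw [RepClass.sound (FinRep.tensor_sum U V W), hf, sub_self]
      | neg U h => simpa using h
      | add a b ha hb => rw [add_mul, map_add, ha, hb, add_zero]
    · simp
    · intro x y _ _ hx hy r
      rw [mul_add, map_add, hx, hy, add_zero]
    · intro a x _ hx r
      rw [smul_eq_mul, ← mul_assoc, hx])

@[simp]
theorem lift_of {A : Type*} [AddCommGroup A] (f : RepClass G → A)
    (hf : ∀ V W : FinRep G, f (.mk (V.sum W)) = f (.mk V) + f (.mk W)) (V : FinRep G) :
    lift f hf (of V) = f (.mk V) :=
  FreeAbelianGroup.lift_apply_of f (RepClass.mk V)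

/-- The ring homomorphism `[V] ↦ [α^* V]` on the free abelian group on isomorphism classes. -/
def resFree (α : K →* G) : FreeAbelianGroup (RepClass G) →+* RU K :=
  FreeAbelianGroup.liftMonoid
    (((Ideal.Quotient.mk (sumIdeal K) : FreeAbelianGroup (RepClass K) →* RU K).comp
      FreeAbelianGroup.ofMulHom).comp (RepClass.res α))

theorem resFree_of (α : K →* G) (V : FinRep G) : resFree α (.of (.mk V)) = of (V.res α) := by
  rw [resFree, FreeAbelianGroup.liftMonoid_coe, FreeAbelianGroup.lift_apply_of]
  rfl

theorem resFree_eq_zero (α : K →* G) (x : FreeAbelianGroup (RepClass G)) (hx : x ∈ sumIdeal G) :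
    resFree α x = 0 := by
  refine (Ideal.span_le (I := RingHom.ker (resFree α))).2 ?_ hx
  rintro _ ⟨V, W, rfl⟩
  rw [SetLike.mem_coe, RingHom.mem_ker, map_sub, map_add, resFree_of, resFree_of, resFree_of,
    sub_eq_zero]
  exact of_sum (V.res α) (W.res α)

/-- Restriction along a homomorphism, `[V] ↦ [α^* V]`. -/
def res (α : K →* G) : RU G →+* RU K :=
  Ideal.Quotient.lift (sumIdeal G) (resFree α) (resFree_eq_zero α)

@[simp]
theorem res_of (α : K →* G) (V : FinRep G) : res α (of V) = of (V.res α) :=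
  resFree_of α V

/-- The transfer from a subgroup, `[V] ↦ [Ind_H^G V]`. -/
def tr [Finite G] (H : Subgroup G) : RU H →+ RU G :=
  lift (fun x => Ideal.Quotient.mk _ (.of (RepClass.ind H x))) (fun V W => by
    rw [RepClass.ind_mk, RepClass.ind_mk, RepClass.ind_mk,
      RepClass.sound (W := (V.ind H).sum (W.ind H)) ⟨indProd H.subtype V.ρ W.ρ⟩]
    exact of_sum (V.ind H) (W.ind H))

@[simp]
theorem tr_of [Finite G] (H : Subgroup G) (V : FinRep H) : tr H (of V) = of (V.ind H) :=
  lift_of _ _ V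

theorem res_id : res (MonoidHom.id G) = RingHom.id (RU G) := by
  refine RingHom.ext fun x => ?_
  induction x using induction with
  | hof V => simp; rfl
  | hneg x h => simpa using h
  | hadd x y h h' => simp_all

theorem res_comp (α : K →* G) (β : L →* K) (x : RU G) : res β (res α x) = res (α.comp β) x := by
  induction x using induction with
  | hof V => simp; rfl
  | hneg x h => simpa using h
  | hadd x y h h' => simp_all

/-- Conjugate homomorphisms have the same restriction map. -/
theorem res_conj (α β : K →* G) (g : G) (h : ∀ x, β x = g * α x * g⁻¹) : res α = res β := by
  refine RingHom.ext fun x => ?_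
  induction x using induction with
  | hof V =>
    simp only [res_of]
    have hV : ∀ a b : G, V.ρ a ∘ₗ V.ρ b = V.ρ (a * b) := fun a b => (map_mul V.ρ a b).symm
    have e : Representation.Equiv (V.ρ.comp α) (V.ρ.comp β) :=
      .mk (.ofLinearMap (V.ρ g) (V.ρ g⁻¹) (by rw [hV, mul_inv_cancel, map_one]; rfl)
        (by rw [hV, inv_mul_cancel, map_one]; rfl)) (fun k => by
        change V.ρ g ∘ₗ V.ρ (α k) = V.ρ (β k) ∘ₗ V.ρ g
        rw [hV, hV, h, inv_mul_cancel_right])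
    exact of_eq ⟨e⟩
  | hneg x h => simpa using h
  | hadd x y h h' => simp_all

/-- Frobenius reciprocity. -/
theorem tr_mul_res [Finite G] (H : Subgroup G) (x : RU H) (y : RU G) :
    tr H (x * res H.subtype y) = tr H x * y := by
  induction x using induction with
  | hof V =>
    induction y using induction with
    | hof W =>
      rw [res_of, tr_of, ← of_tensor, ← of_tensor, tr_of]
      exact of_eq ⟨indTensor H.subtype V.ρ W.ρ⟩
    | hneg x h => simpa using h
    | hadd x y h h' => simp_all [mul_add]
  | hneg x h => simpa using h
  | hadd x y h h' => simp_all [add_mul]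

/-- Inflations commute with transfers. -/
theorem res_tr [Finite G] [Finite K] (α : K →* G) (hα : Function.Surjective α) (H : Subgroup G)
    (x : RU H) : res α (tr H x) = tr (H.comap α) (res (comapHom α H) x) := by
  induction x using induction with
  | hof V =>
    simp only [res_of, tr_of]
    exact (of_eq ⟨indComap α hα H V.ρ⟩).symm
  | hneg x h => simpa using h
  | hadd x y h h' => simp_all

end RU

/-! ## Rationalization and the quotient by proper transfers -/

/-- The rationalized representation ring `ℚ ⊗ RU(G)`. -/
abbrev RUQ (G : Type) [Group G] : Type 1 := ℚ ⊗[ℤ] RU G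

namespace RUQ

/-- The class of a representation in the rationalized representation ring. -/
def of (V : FinRep G) : RUQ G := 1 ⊗ₜ RU.of V

/-- Rationalized restriction. -/
def res (α : K →* G) : RUQ G →ₐ[ℚ] RUQ K :=
  Algebra.TensorProduct.map (AlgHom.id ℚ ℚ) (RU.res α).toIntAlgHom

/-- Rationalized transfer. -/
def tr [Finite G] (H : Subgroup G) : RUQ H →ₗ[ℚ] RUQ G :=
  LinearMap.baseChange ℚ (RU.tr H).toIntLinearMap

@[simp]
theorem res_tmul (α : K →* G) (q : ℚ) (x : RU G) : res α (q ⊗ₜ x) = q ⊗ₜ RU.res α x := rfl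

@[simp]
theorem tr_tmul [Finite G] (H : Subgroup G) (q : ℚ) (x : RU H) :
    tr H (q ⊗ₜ x) = q ⊗ₜ RU.tr H x := rfl

theorem tr_mul_res [Finite G] (H : Subgroup G) (x : RUQ H) (y : RUQ G) :
    tr H (x * res H.subtype y) = tr H x * y := by
  induction x using TensorProduct.induction_on with
  | zero => simp
  | add a b ha hb => simp only [add_mul, map_add, ha, hb]
  | tmul q a =>
    induction y using TensorProduct.induction_on with
    | zero => simp
    | add c d hc hd => simp only [mul_add, map_add, hc, hd]
    | tmul r b => simp [RU.tr_mul_res]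

theorem res_tr [Finite G] [Finite K] (α : K →* G) (hα : Function.Surjective α) (H : Subgroup G)
    (x : RUQ H) : res α (tr H x) = tr (H.comap α) (res (comapHom α H) x) := by
  induction x using TensorProduct.induction_on with
  | zero => simp
  | add a b ha hb => simp only [map_add, ha, hb]
  | tmul q a => simp [RU.res_tr α hα]

end RUQ

/-- The sum of the images of the transfers from all proper subgroups of `G`. By Frobenius
reciprocity it is an ideal. -/
def transferIdeal (G : Type) [Group G] [Finite G] : Ideal (RUQ G) where
  __ := (⨆ H : {H : Subgroup G // H ≠ ⊤}, LinearMap.range (RUQ.tr H.1) : Submodule ℚ (RUQ G))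
  smul_mem' := by
    intro y x hx
    change x ∈ (⨆ H : {H : Subgroup G // H ≠ ⊤}, LinearMap.range (RUQ.tr H.1)) at hx
    change y * x ∈ (⨆ H : {H : Subgroup G // H ≠ ⊤}, LinearMap.range (RUQ.tr H.1))
    induction hx using Submodule.iSup_induction' with
    | mem H x hx =>
      obtain ⟨z, rfl⟩ := hx
      refine Submodule.mem_iSup_of_mem H ⟨z * RUQ.res H.1.subtype y, ?_⟩
      rw [RUQ.tr_mul_res, mul_comm]
    | zero => simp
    | add a b _ _ ha hb => rw [mul_add]; exact add_mem ha hb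

theorem mem_transferIdeal [Finite G] {x : RUQ G} : x ∈ transferIdeal G ↔
    x ∈ (⨆ H : {H : Subgroup G // H ≠ ⊤}, LinearMap.range (RUQ.tr H.1)) := Iff.rfl

theorem transferIdeal_le_comap [Finite G] [Finite K] (α : K →* G)
    (hα : Function.Surjective α) :
    transferIdeal G ≤ (transferIdeal K).comap (RUQ.res α) := by
  intro x hx
  rw [mem_transferIdeal] at hx
  rw [Ideal.mem_comap, mem_transferIdeal]
  induction hx using Submodule.iSup_induction' with
  | mem H x hx =>
    obtain ⟨z, rfl⟩ := hx
    refine Submodule.mem_iSup_of_mem ⟨H.1.comap α, fun h => H.2 ?_⟩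
      ⟨RUQ.res (comapHom α H.1) z, ?_⟩
    · rw [eq_top_iff]
      intro g _
      obtain ⟨k, rfl⟩ := hα g
      have : k ∈ H.1.comap α := h ▸ Subgroup.mem_top k
      exact this
    · exact (RUQ.res_tr α hα H.1 z).symm
  | zero => simp
  | add a b _ _ ha hb => rw [map_add]; exact add_mem ha hb

/-- The value of `τ(RU_ℚ)` at `G`: the rationalized representation ring modulo the transfers
from proper subgroups. -/
def Tau (G : Type) [Group G] [Finite G] : Type 1 := RUQ G ⧸ transferIdeal G

instance (G : Type) [Group G] [Finite G] : CommRing (Tau G) :=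
  inferInstanceAs (CommRing (RUQ G ⧸ transferIdeal G))

instance (G : Type) [Group G] [Finite G] : Algebra ℚ (Tau G) :=
  inferInstanceAs (Algebra ℚ (RUQ G ⧸ transferIdeal G))

/-- The projection `RU_ℚ(G) → τ(RU_ℚ)(G)`. -/
def Tau.mk (G : Type) [Group G] [Finite G] : RUQ G →ₐ[ℚ] Tau G :=
  Ideal.Quotient.mkₐ ℚ (transferIdeal G)

theorem Tau.mk_surjective (G : Type) [Group G] [Finite G] : Function.Surjective (Tau.mk G) :=
  Ideal.Quotient.mkₐ_surjective ℚ (transferIdeal G)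

theorem Tau.mk_eq_zero [Finite G] (x : RUQ G) : Tau.mk G x = 0 ↔ x ∈ transferIdeal G :=
  Ideal.Quotient.eq_zero_iff_mem

/-- The class of a representation in `τ(RU_ℚ)(G)`. -/
def Tau.of [Finite G] (V : FinRep G) : Tau G := Tau.mk G (RUQ.of V)

/-- The inflation `τ(RU_ℚ)(G) → τ(RU_ℚ)(K)` along a surjection `α : K → G`. -/
def Tau.res [Finite G] [Finite K] (α : K →* G) (hα : Function.Surjective α) : Tau G →ₐ[ℚ] Tau K :=
  Ideal.quotientMapₐ (transferIdeal K) (RUQ.res α) (transferIdeal_le_comap α hα)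

theorem Tau.res_mk [Finite G] [Finite K] (α : K →* G) (hα : Function.Surjective α) (x : RUQ G) :
    Tau.res α hα (Tau.mk G x) = Tau.mk K (RUQ.res α x) := rfl

end RepRing
namespace RUQ

variable {G K L : Type} [Group G] [Group K] [Group L]

theorem res_id (x : RUQ G) : res (MonoidHom.id G) x = x := by
  induction x using TensorProduct.induction_on with
  | zero => simp
  | add a b ha hb => rw [map_add, ha, hb]
  | tmul q a => simp [RU.res_id]

theorem res_comp (α : K →* G) (β : L →* K) (x : RUQ G) :
    res β (res α x) = res (α.comp β) x := by
  induction x using TensorProduct.induction_on with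
  | zero => simp
  | add a b ha hb => simp only [map_add, ha, hb]
  | tmul q a => simp [RU.res_comp]

theorem res_conj (α β : K →* G) (g : G) (h : ∀ x, β x = g * α x * g⁻¹) : res α = res β := by
  rw [res, res, RU.res_conj α β g h]

end RUQ

namespace Tau

variable {G K L : Type} [Group G] [Group K] [Group L] [Finite G] [Finite K] [Finite L]

theorem res_id (h : Function.Surjective (MonoidHom.id G)) :
    res (MonoidHom.id G) h = AlgHom.id ℚ (Tau G) := by
  refine AlgHom.ext fun x => ?_
  obtain ⟨x, rfl⟩ := Tau.mk_surjective _ x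
  exact congrArg (Tau.mk _) (RUQ.res_id x)

theorem res_comp (α : K →* G) (hα : Function.Surjective α) (β : L →* K)
    (hβ : Function.Surjective β) (h : Function.Surjective (α.comp β)) :
    (res β hβ).comp (res α hα) = res (α.comp β) h := by
  refine AlgHom.ext fun x => ?_
  obtain ⟨x, rfl⟩ := Tau.mk_surjective _ x
  exact congrArg (Tau.mk _) (RUQ.res_comp α β x)

theorem res_conj (α β : K →* G) (hα : Function.Surjective α) (hβ : Function.Surjective β) (g : G)
    (h : ∀ x, β x = g * α x * g⁻¹) : res α hα = res β hβ := by
  refine AlgHom.ext fun x => ?_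
  obtain ⟨x, rfl⟩ := Tau.mk_surjective _ x
  exact congrArg (Tau.mk _) (by rw [RUQ.res_conj α β g h])

end Tau

/-! ## The categories `Out` and `Out_cyc` -/

/-- A finite group, as an object of the category `Out` of finite groups and conjugacy classes of
surjective homomorphisms. -/
structure Out where
  /-- The underlying group. -/
  carrier : Type
  [group : Group carrier]
  [finite : Finite carrier]

attribute [instance] Out.group Out.finite

namespace Out

/-- Surjective homomorphisms. -/
abbrev Epi (G H : Out) : Type := {f : G.carrier →* H.carrier // Function.Surjective f}

/-- Two homomorphisms are conjugate if they differ by an inner automorphism of the target. -/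
instance conj (G H : Out) : Setoid (Epi G H) where
  r α β := ∃ h : H.carrier, ∀ x, β.1 x = h * α.1 x * h⁻¹
  iseqv := by
    refine ⟨fun α => ⟨1, by simp⟩, ?_, ?_⟩
    · rintro α β ⟨h, hh⟩
      exact ⟨h⁻¹, fun x => by rw [hh]; group⟩
    · rintro α β γ ⟨h, hh⟩ ⟨k, hk⟩
      exact ⟨k * h, fun x => by rw [hk, hh]; group⟩

instance : Category Out where
  Hom G H := Quotient (conj G H)
  id G := Quotient.mk _ ⟨MonoidHom.id _, Function.surjective_id⟩
  comp := Quotient.map₂ (fun α β => ⟨β.1.comp α.1, β.2.comp α.2⟩) (by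
    rintro α α' ⟨h, hh⟩ β β' ⟨k, hk⟩
    refine ⟨k * β.1 h, fun x => ?_⟩
    simp only [MonoidHom.comp_apply]
    rw [hk, hh, map_mul, map_mul, map_inv]
    group)
  id_comp := by rintro _ _ ⟨α⟩; rfl
  comp_id := by rintro _ _ ⟨α⟩; rfl
  assoc := by rintro _ _ _ _ ⟨α⟩ ⟨β⟩ ⟨γ⟩; rfl

/-- The conjugacy class of a surjective homomorphism, as a morphism of `Out`. -/
def homMk {G H : Out} (α : G.carrier →* H.carrier) (hα : Function.Surjective α) : G ⟶ H :=
  Quotient.mk (conj G H) ⟨α, hα⟩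

end Out

/-- The `Out^op`-module `τ(RU_ℚ)`. -/
def tauRU : Outᵒᵖ ⥤ ModuleCat.{1} ℚ where
  obj G := ModuleCat.of ℚ (Tau G.unop.carrier)
  map {G H} f := Quotient.lift
    (fun α : Out.Epi H.unop G.unop => ModuleCat.ofHom (Tau.res α.1 α.2).toLinearMap)
    (by
      rintro α β ⟨g, hg⟩
      rw [Tau.res_conj α.1 β.1 α.2 β.2 g hg]) f.unop
  map_id G := by
    change ModuleCat.ofHom (Tau.res (MonoidHom.id _) Function.surjective_id).toLinearMap = _
    rw [Tau.res_id]
    rfl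
  map_comp {G H K} f g := by
    obtain ⟨f⟩ := f
    obtain ⟨g⟩ := g
    obtain ⟨α, rfl⟩ := Quotient.mk_surjective f
    obtain ⟨β, rfl⟩ := Quotient.mk_surjective g
    change ModuleCat.ofHom (Tau.res (α.1.comp β.1) (α.2.comp β.2)).toLinearMap =
      ModuleCat.ofHom (Tau.res α.1 α.2).toLinearMap ≫
        ModuleCat.ofHom (Tau.res β.1 β.2).toLinearMap
    rw [← Tau.res_comp α.1 α.2 β.1 β.2]
    rfl

/-- The cyclic group `C_n ⊂ ℂˣ` of `n`-th roots of unity. -/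
abbrev C (n : ℕ+) : Type := rootsOfUnity (n : ℕ) ℂ

/-- The full subcategory of `Out` on the groups `C_n` for `n ≥ 1`. -/
abbrev OutCyc : Type := InducedCategory Out (fun n : ℕ+ => Out.mk (C n))

/-- The inclusion of `Out_cyc` into `Out`. -/
abbrev OutCyc.ι : OutCyc ⥤ Out := inducedFunctor _

/-- The object `C_n` of `Out_cyc`. -/
abbrev OutCyc.of (n : ℕ+) : OutCyc := n

/-- The one-dimensional tautological representation of `C_n ⊂ ℂˣ`. -/
def taut (n : ℕ+) : FinRep (C n) where
  V := ℂ
  ρ := (Algebra.lsmul ℂ ℂ ℂ : ℂ →ₐ[ℂ] Module.End ℂ ℂ).toMonoidHom.comp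
    ((Units.coeHom ℂ).comp (rootsOfUnity (n : ℕ) ℂ).subtype)

theorem taut_apply (n : ℕ+) (x : C n) (z : ℂ) : (taut n).ρ x z = ((x : ℂˣ) : ℂ) * z := rfl

/-- The preferred projection `C_m → C_n`, `x ↦ x ^ (m / n)`, for `n ∣ m`. It sends the generator
`exp (2πi/m)` to `exp (2πi/n)`. -/
def proj {m n : ℕ+} (h : (n : ℕ) ∣ m) : C m →* C n :=
  ((powMonoidHom (m / n : ℕ)).comp (rootsOfUnity (m : ℕ) ℂ).subtype).codRestrict _ (fun x => by
    rw [mem_rootsOfUnity]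
    change ((x : ℂˣ) ^ (m / n : ℕ)) ^ (n : ℕ) = 1
    rw [← pow_mul, Nat.div_mul_cancel h]
    exact x.2)

theorem proj_coe {m n : ℕ+} (h : (n : ℕ) ∣ m) (x : C m) :
    ((proj h x : C n) : ℂˣ) = (x : ℂˣ) ^ (m / n : ℕ) := rfl

theorem proj_surjective {m n : ℕ+} (h : (n : ℕ) ∣ m) : Function.Surjective (proj h) := by
  intro y
  obtain ⟨k, hk⟩ := h
  have hm : (m : ℕ) / n = k := by rw [hk]; exact Nat.mul_div_cancel_left _ n.pos
  have hk0 : k ≠ 0 := by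
    rintro rfl
    exact m.ne_zero (by simp at hk)
  obtain ⟨z, hz⟩ := IsAlgClosed.exists_pow_nat_eq ((y : ℂˣ) : ℂ) (Nat.pos_of_ne_zero hk0)
  have hz0 : z ≠ 0 := by
    rintro rfl
    rw [zero_pow hk0] at hz
    exact (y : ℂˣ).ne_zero hz.symm
  have hu : (Units.mk0 z hz0) ^ k = (y : ℂˣ) := Units.ext (by simpa using hz)
  refine ⟨⟨Units.mk0 z hz0, ?_⟩, ?_⟩
  · rw [mem_rootsOfUnity, hk, mul_comm, pow_mul, hu]
    exact y.2
  · apply Subtype.ext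
    rw [proj_coe, hm]
    exact hu

/-- The preferred projection as a morphism of `Out_cyc`. -/
def projHom {m n : ℕ+} (h : (n : ℕ) ∣ m) : OutCyc.of m ⟶ OutCyc.of n :=
  InducedCategory.homMk (Out.homMk (proj h) (proj_surjective h))

theorem dvd_of_hom {m n : ℕ+} (f : OutCyc.of m ⟶ OutCyc.of n) : (n : ℕ) ∣ m := by
  obtain ⟨α, -⟩ := Quotient.mk_surjective f.hom
  have := Subgroup.card_range_dvd α.1
  rw [MonoidHom.range_eq_top.2 α.2] at this
  simpa [Complex.card_rootsOfUnity] using this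

/-! ## The `Out_cyc^op`-module of regular representations -/

theorem outCyc_hom_eq_mk {m n : ℕ+} (f : OutCyc.of m ⟶ OutCyc.of n) :
    ∃ (α : C m →* C n) (hα : Function.Surjective α),
      f = InducedCategory.homMk (Out.homMk α hα) := by
  obtain ⟨α, hα⟩ := Quotient.mk_surjective f.hom
  exact ⟨α.1, α.2, InducedCategory.hom_ext hα.symm⟩

theorem outCyc_homMk_inj {m n : ℕ+} {α β : C m →* C n} {hα : Function.Surjective α}
    {hβ : Function.Surjective β}
    (h : (InducedCategory.homMk (Out.homMk α hα) : OutCyc.of m ⟶ OutCyc.of n) =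
      InducedCategory.homMk (Out.homMk β hβ)) : α = β := by
  obtain ⟨g, hg⟩ := Quotient.exact (congrArg InducedCategory.Hom.hom h)
  refine MonoidHom.ext fun x => ?_
  have := hg x
  exact ((this.trans (mul_inv_cancel_comm g (α x)))).symm

instance (m n : ℕ+) : Finite (OutCyc.of m ⟶ OutCyc.of n) := by
  have : Finite (C m →* C n) := Finite.of_injective (fun f => (f : C m → C n)) DFunLike.coe_injective
  refine Finite.of_surjective (α := {α : C m →* C n // Function.Surjective α})
    (fun α => InducedCategory.homMk (Out.homMk α.1 α.2)) fun f => ?_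
  obtain ⟨α, hα, rfl⟩ := outCyc_hom_eq_mk f
  exact ⟨⟨α, hα⟩, rfl⟩

instance (n : ℕ+) : Finite (Aut (OutCyc.of n)) :=
  Finite.of_injective (fun a => a.hom) fun _ _ h => Iso.ext h

instance (n : ℕ+) : Fintype (Aut (OutCyc.of n)) := Fintype.ofFinite _

/-- Any two morphisms `C_m → C_n` of `Out_cyc` differ by a unique automorphism of the target. -/
theorem existsUnique_aut {m n : ℕ+} (f g : OutCyc.of m ⟶ OutCyc.of n) :
    ∃! a : Aut (OutCyc.of n), f ≫ a.hom = g := by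
  obtain ⟨α, hα, rfl⟩ := outCyc_hom_eq_mk f
  obtain ⟨β, hβ, rfl⟩ := outCyc_hom_eq_mk g
  obtain ⟨t, ht⟩ := IsCyclic.exists_generator (α := C m)
  have hgen : ∀ y : C n, ∃ k : ℤ, α t ^ k = y := by
    intro y
    obtain ⟨x, rfl⟩ := hα y
    obtain ⟨k, rfl⟩ := Subgroup.mem_zpowers_iff.1 (ht x)
    exact ⟨k, (map_zpow α t k).symm⟩
  obtain ⟨k, hk⟩ := hgen (β t)
  have hkx : ∀ x, α x ^ k = β x := by
    intro x
    obtain ⟨j, rfl⟩ := Subgroup.mem_zpowers_iff.1 (ht x)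
    rw [map_zpow, map_zpow, ← hk, ← zpow_mul, ← zpow_mul, mul_comm]
  have hs : Function.Surjective (zpowGroupHom k : C n →* C n) := by
    intro y
    obtain ⟨x, rfl⟩ := hβ y
    exact ⟨α x, hkx x⟩
  let e : C n ≃* C n := MulEquiv.ofBijective (zpowGroupHom k : C n →* C n)
    ⟨Finite.injective_iff_surjective.2 hs, hs⟩
  let a : Aut (OutCyc.of n) :=
    { hom := InducedCategory.homMk (Out.homMk e.toMonoidHom e.surjective)
      inv := InducedCategory.homMk (Out.homMk e.symm.toMonoidHom e.symm.surjective)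
      hom_inv_id := by
        refine InducedCategory.hom_ext (congrArg (Quotient.mk _) (Subtype.ext ?_))
        exact MonoidHom.ext fun x => e.symm_apply_apply x
      inv_hom_id := by
        refine InducedCategory.hom_ext (congrArg (Quotient.mk _) (Subtype.ext ?_))
        exact MonoidHom.ext fun x => e.apply_symm_apply x }
  refine ⟨a, ?_, ?_⟩
  · refine InducedCategory.hom_ext (congrArg (Quotient.mk _) (Subtype.ext ?_))
    exact MonoidHom.ext fun x => hkx x
  · intro b hb
    obtain ⟨γ, hγ, hbγ⟩ := outCyc_hom_eq_mk b.hom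
    refine Iso.ext (hbγ.trans ?_)
    rw [hbγ] at hb
    have h1 : γ.comp α = β := outCyc_homMk_inj (hα := hγ.comp hα) (hβ := hβ) hb
    refine congrArg InducedCategory.homMk (congrArg (Quotient.mk _) (Subtype.ext ?_))
    refine MonoidHom.ext fun y => ?_
    obtain ⟨x, rfl⟩ := hα y
    exact (DFunLike.congr_fun h1 x).trans (hkx x).symm

theorem projHom_self (n : ℕ+) : projHom (dvd_refl (n : ℕ)) = 𝟙 (OutCyc.of n) := by
  refine InducedCategory.hom_ext (congrArg (Quotient.mk _) (Subtype.ext ?_))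
  refine MonoidHom.ext fun x => Subtype.ext ?_
  change ((x : C n) : ℂˣ) ^ (n / n : ℕ) = x
  rw [Nat.div_self n.pos, pow_one]

theorem projHom_comp {l m n : ℕ+} (h : (m : ℕ) ∣ l) (h' : (n : ℕ) ∣ m) :
    projHom h ≫ projHom h' = projHom (h'.trans h) := by
  refine InducedCategory.hom_ext (congrArg (Quotient.mk _) (Subtype.ext ?_))
  refine MonoidHom.ext fun x => Subtype.ext ?_
  change (((x : C l) : ℂˣ) ^ (l / m : ℕ)) ^ (m / n : ℕ) = ((x : C l) : ℂˣ) ^ (l / n : ℕ)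
  rw [← pow_mul]
  exact congrArg _ (Nat.div_mul_div h h')

open Classical in
/-- The automorphisms `j'` of `C_m` lying over `j ∘ f`, i.e. with `p ∘ j' = j ∘ f` for the
preferred projection `p : C_m → C_n`. For `f = p` this is the fiber over `j` of the surjection
`Out(C_m) → Out(C_n)`. -/
def fiber {m n : ℕ+} (f : OutCyc.of m ⟶ OutCyc.of n) (j : Aut (OutCyc.of n)) :
    Finset (Aut (OutCyc.of m)) :=
  Finset.univ.filter fun j' => j'.hom ≫ projHom (dvd_of_hom f) = f ≫ j.hom

theorem mem_fiber {m n : ℕ+} (f : OutCyc.of m ⟶ OutCyc.of n) (j : Aut (OutCyc.of n))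
    (j' : Aut (OutCyc.of m)) :
    j' ∈ fiber f j ↔ j'.hom ≫ projHom (dvd_of_hom f) = f ≫ j.hom := by
  simp [fiber]

/-- The restriction `ℚ[Out(C_n)] → ℚ[Out(C_m)]` along `f : C_m → C_n`. For the preferred
projection it is summation over the fibers of `Out(C_m) → Out(C_n)`, and for `f ∈ Out(C_n)` it is
multiplication by `f` in the regular representation. -/
def regMap {m n : ℕ+} (f : OutCyc.of m ⟶ OutCyc.of n) :
    (Aut (OutCyc.of n) →₀ ℚ) →ₗ[ℚ] (Aut (OutCyc.of m) →₀ ℚ) :=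
  Finsupp.linearCombination ℚ fun j => ∑ j' ∈ fiber f j, Finsupp.single j' (1 : ℚ)

theorem regMap_single {m n : ℕ+} (f : OutCyc.of m ⟶ OutCyc.of n) (j : Aut (OutCyc.of n)) :
    regMap f (Finsupp.single j 1) = ∑ j' ∈ fiber f j, Finsupp.single j' (1 : ℚ) := by
  simp [regMap]

theorem regMap_id (n : ℕ+) : regMap (𝟙 (OutCyc.of n)) = LinearMap.id := by
  refine Finsupp.lhom_ext' fun j => LinearMap.ext_ring ?_
  change regMap (𝟙 (OutCyc.of n)) (Finsupp.single j 1) = Finsupp.single j 1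
  rw [regMap_single]
  have : fiber (𝟙 (OutCyc.of n)) j = {j} := by
    ext j'
    rw [mem_fiber, projHom_self, Category.comp_id, Category.id_comp, Finset.mem_singleton]
    exact ⟨fun h => Iso.ext h, fun h => by rw [h]⟩
  rw [this, Finset.sum_singleton]

theorem regMap_comp {l m n : ℕ+} (g : OutCyc.of l ⟶ OutCyc.of m)
    (f : OutCyc.of m ⟶ OutCyc.of n) : regMap (g ≫ f) = regMap g ∘ₗ regMap f := by
  classical
  refine Finsupp.lhom_ext' fun j => LinearMap.ext_ring ?_
  change regMap (g ≫ f) (Finsupp.single j 1) = regMap g (regMap f (Finsupp.single j 1))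
  rw [regMap_single, regMap_single, map_sum]
  simp only [regMap_single]
  rw [← Finset.sum_biUnion]
  · refine Finset.sum_congr ?_ fun _ _ => rfl
    ext j''
    simp only [Finset.mem_biUnion, mem_fiber]
    rw [← projHom_comp (dvd_of_hom g) (dvd_of_hom f)]
    constructor
    · intro h
      obtain ⟨j', hj', -⟩ := existsUnique_aut g (j''.hom ≫ projHom (dvd_of_hom g))
      refine ⟨j', ?_, hj'.symm⟩
      obtain ⟨a, -, ha⟩ := existsUnique_aut g g
      obtain ⟨b, hb, -⟩ := existsUnique_aut (j'.hom ≫ projHom (dvd_of_hom f)) (f ≫ j.hom)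
      have h2 : (g ≫ j'.hom ≫ projHom (dvd_of_hom f)) ≫ b.hom =
          g ≫ j'.hom ≫ projHom (dvd_of_hom f) := by
        have h4 : g ≫ j'.hom ≫ projHom (dvd_of_hom f) = g ≫ f ≫ j.hom := by
          have h5 := congrArg (· ≫ projHom (dvd_of_hom f)) hj'
          simp only [Category.assoc] at h5
          rw [h5, h]
          exact Category.assoc _ _ _
        refine (Category.assoc _ _ _).trans ((congrArg (g ≫ ·) hb).trans h4.symm)
      have h3 : b = Iso.refl _ := (existsUnique_aut (g ≫ j'.hom ≫ projHom (dvd_of_hom f))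
        (g ≫ j'.hom ≫ projHom (dvd_of_hom f))).unique h2 (Category.comp_id _)
      rw [← hb, h3]
      exact (Category.comp_id _).symm
    · rintro ⟨j', h1, h2⟩
      rw [← Category.assoc, h2, Category.assoc, h1, Category.assoc]
  · intro a _ b _ hab
    rw [Function.onFun, Finset.disjoint_left]
    intro j'' ha hb
    rw [mem_fiber] at ha hb
    exact hab ((existsUnique_aut g _).unique ha.symm hb.symm)

/-- The `Out_cyc^op`-module `ℚ[Out(-)]` of regular representations. -/
def regOut : OutCycᵒᵖ ⥤ ModuleCat.{0} ℚ where
  obj X := ModuleCat.of ℚ (Aut X.unop →₀ ℚ)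
  map {X Y} f := ModuleCat.ofHom (regMap (m := Y.unop) (n := X.unop) f.unop)
  map_id X := by
    change ModuleCat.ofHom (regMap (𝟙 (OutCyc.of X.unop))) = _
    rw [regMap_id]
    rfl
  map_comp {X Y Z} f g := by
    change ModuleCat.ofHom (regMap (m := Z.unop) (n := X.unop) (g.unop ≫ f.unop)) = _
    exact congrArg ModuleCat.ofHom
      (regMap_comp (l := Z.unop) (m := Y.unop) (n := X.unop) g.unop f.unop)

/-- The classifying element `x_n ∈ τ(RU_ℚ)(C_n)` of a morphism `ℚ[Out(-)] → τ(RU_ℚ)` of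
`Out_cyc^op`-modules: the image of the identity element `1 ∈ Out(C_n)`. -/
def classifying (φ : regOut ⋙ ModuleCat.uliftFunctor.{1} ℚ ⟶ OutCyc.ι.op ⋙ tauRU) (n : ℕ+) :
    Tau (C n) :=
  (φ.app (Opposite.op (OutCyc.of n))).hom
    (ULift.up (Finsupp.single (1 : Aut (OutCyc.of n)) (1 : ℚ)))

end GlobalRU

end

noncomputable section

namespace GlobalRU

/-! ## Normal generators of cyclotomic fields -/

section NormalGen

variable {R S : Type*} [CommRing R] [Algebra ℚ R] [CommRing S] [Algebra ℚ S]

/-! Evaluating characters at the generator `exp (2πi/n)` of `C n` identifies τ(RU_ℚ)(C_n) with the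
cyclotomic field ℚ(ζ_n). Every representation of `C n` is a sum of powers of the tautological one,
so the ring is a quotient of ℚ[X]. Transfers from proper subgroups vanish at the generator
(`charAt_gen_transferIdeal`). Conversely, the transfer of 1 from the subgroup of order d < n makes
Φ_d invertible (`isUnit_aeval_cyclotomic`), so X^n - 1 = 0 forces Φ_n = 0 and `evalGen` is
injective.

In these terms inflation along a preferred projection is the inclusion ℚ(ζ_n) ⊂ ℚ(ζ_m), and Out(C_n)
acts as the Galois group. A morphism out of ℚ[Out(-)] is therefore a family x_n with trace of x_m
equal to x_n for n ∣ m, and it is an isomorphism when the conjugates of each x_n form a basis of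
ℚ(ζ_n).

Both properties hold for `normalGen`, a product of one factor per prime. Trace compatibility
(`normalGen_trace`) reduces to steps of prime index, where it follows from the vanishing of power
sums over all p-th roots of a number: the powers of 1/p balance the p equal contributions when p ∣
n, and the sign makes the trace 1 when p is new. Spanning (`mem_normalSpan`) follows by induction
over prime powers and multiplicativity over coprime orders. Since both sides have dimension φ(n),
spanning suffices (`orbitMap_bijective`). -/

/-- The element `-(z + z ^ p + ⋯ + z ^ p ^ (k - 1)) / p ^ (k - 1)`. -/
def primePart (p k : ℕ) (z : R) : R :=
  (-1 / (p : ℚ) ^ (k - 1)) • ∑ i ∈ Finset.range k, z ^ p ^ i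

/-- For `z` a primitive `n`-th root of unity, a generator of a normal basis of `ℚ(z)`. -/
def normalGen (n : ℕ) (z : R) : R :=
  ∏ p ∈ n.primeFactors, primePart p (n.factorization p) (z ^ (n / p ^ n.factorization p))

theorem map_primePart (f : R →ₐ[ℚ] S) (p k : ℕ) (z : R) :
    f (primePart p k z) = primePart p k (f z) := by
  simp [primePart]

theorem map_normalGen (f : R →ₐ[ℚ] S) (n : ℕ) (z : R) :
    f (normalGen n z) = normalGen n (f z) := by
  simp [normalGen, map_primePart]

@[simp]
theorem normalGen_one (z : R) : normalGen 1 z = 1 := by simp [normalGen]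

theorem normalGen_prime_pow {p : ℕ} (hp : p.Prime) (k : ℕ) (z : R) :
    normalGen (p ^ (k + 1)) z = primePart p (k + 1) z := by
  rw [normalGen, Nat.primeFactors_prime_pow k.succ_ne_zero hp, Finset.prod_singleton,
    hp.factorization_pow, Finsupp.single_eq_same, Nat.div_self (pow_pos hp.pos _), pow_one]

/-- A prime p ∣ m has the same exponent v in m and in mn, and mn / p^v = n · (m / p^v), so its
factor is the one formed from z^n. This yields the multiplicativity clause of the theorem. -/
theorem normalGen_mul {m n : ℕ} (h : m.Coprime n) (z : R) :
    normalGen (m * n) z = normalGen m (z ^ n) * normalGen n (z ^ m) := by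
  rw [normalGen, h.primeFactors_mul, Finset.prod_union h.disjoint_primeFactors, normalGen,
    normalGen]
  congr 1
  · refine Finset.prod_congr rfl fun p hp => ?_
    rw [Nat.factorization_eq_of_coprime_left h (by simpa using hp), ← pow_mul,
      mul_comm m n, Nat.mul_div_assoc _ (Nat.ordProj_dvd m p)]
  · refine Finset.prod_congr rfl fun p hp => ?_
    rw [Nat.factorization_eq_of_coprime_right h (by simpa using hp), ← pow_mul,
      Nat.mul_div_assoc _ (Nat.ordProj_dvd n p)]

theorem primePart_one (p : ℕ) (z : R) : primePart p 1 z = -z := by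
  simp [primePart]

/-- Splits off the term i = 0; the remaining terms form the same expression at z^p, rescaled by 1/p.
Both the trace formula and the spanning argument at powers of p rest on this recursion. -/
theorem primePart_add_two {p : ℕ} (hp : p ≠ 0) (k : ℕ) (z : R) :
    primePart p (k + 2) z =
      (-1 / (p : ℚ) ^ (k + 1)) • z + (1 / (p : ℚ)) • primePart p (k + 1) (z ^ p) := by
  have hp' : (p : ℚ) ≠ 0 := by exact_mod_cast hp
  have e : 1 / (p : ℚ) * (-1 / (p : ℚ) ^ k) = -1 / (p : ℚ) ^ (k + 1) := by
    field_simp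
    ring
  have e' : k + 2 - 1 = k + 1 := rfl
  rw [primePart, primePart, smul_smul, Nat.add_sub_cancel, e, e', ← smul_add,
    Finset.sum_range_succ', pow_zero, pow_one, add_comm z]
  congr 2
  refine Finset.sum_congr rfl fun i _ => ?_
  rw [← pow_mul, pow_succ']

end NormalGen

/-! ### Trace compatibility of the normal generators -/

section Trace

/-- The numbers an and bm represent the two complementary idempotents of ℤ/mn. As exponents they
split an mn-th root of unity into its parts of order dividing m and n. -/
theorem exists_add_modEq {m n : ℕ} (h : m.Coprime n) :
    ∃ a b : ℕ, a * n ≡ 1 [MOD m] ∧ b * m ≡ 1 [MOD n] ∧ a * n + b * m ≡ 1 [MOD m * n] := by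
  obtain ⟨x, hx1, hx2⟩ := Nat.chineseRemainder h 1 0
  obtain ⟨y, hy1, hy2⟩ := Nat.chineseRemainder h 0 1
  obtain ⟨a, rfl⟩ := (Nat.modEq_zero_iff_dvd).1 hx2
  obtain ⟨b, rfl⟩ := (Nat.modEq_zero_iff_dvd).1 hy1
  refine ⟨a, b, by rwa [mul_comm], by rwa [mul_comm], ?_⟩
  rw [mul_comm a, mul_comm b]
  exact (Nat.modEq_and_modEq_iff_modEq_mul h).1
    ⟨by simpa using hx1.add hy1, by simpa using hx2.add hy2⟩

theorem mem_toFinset_nthRoots {p : ℕ} (hp : p.Prime) (u w : ℂ) :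
    w ∈ (Polynomial.nthRoots p u).toFinset ↔ w ^ p = u := by
  rw [Multiset.mem_toFinset, Polynomial.mem_nthRoots hp.pos]

theorem card_nthRoots_toFinset {p : ℕ} (hp : p.Prime) {u : ℂ} (hu : u ≠ 0) :
    (Polynomial.nthRoots p u).toFinset.card = p := by
  have : NeZero p := ⟨hp.ne_zero⟩
  have hξ := Complex.isPrimitiveRoot_exp p hp.ne_zero
  rw [Multiset.toFinset_card_of_nodup (hξ.nthRoots_nodup hu), hξ.card_nthRoots, if_pos]
  exact IsAlgClosed.exists_pow_nat_eq u hp.pos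

/-- Multiplication by a primitive p-th root of unity ξ permutes the p-th roots of u and scales the
sum by ξ^c ≠ 1. -/
theorem sum_nthRoots_pow {p : ℕ} (hp : p.Prime) (u : ℂ) {c : ℕ} (hc : ¬ p ∣ c) :
    ∑ w ∈ (Polynomial.nthRoots p u).toFinset, w ^ c = 0 := by
  have hξ := Complex.isPrimitiveRoot_exp p hp.ne_zero
  set ξ := Complex.exp (2 * Real.pi * Complex.I / p)
  have h0 : ξ ≠ 0 := hξ.ne_zero hp.ne_zero
  have h : ξ ^ c * ∑ w ∈ (Polynomial.nthRoots p u).toFinset, w ^ c =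
      ∑ w ∈ (Polynomial.nthRoots p u).toFinset, w ^ c := by
    rw [Finset.mul_sum]
    refine Finset.sum_bij (fun w _ => ξ * w) ?_ ?_ ?_ ?_
    · intro w hw
      rw [mem_toFinset_nthRoots hp] at hw ⊢
      rw [mul_pow, hξ.pow_eq_one, one_mul, hw]
    · intro a _ b _ hab
      exact mul_left_cancel₀ h0 hab
    · intro w hw
      refine ⟨ξ⁻¹ * w, ?_, mul_inv_cancel_left₀ h0 w⟩
      rw [mem_toFinset_nthRoots hp] at hw ⊢
      rw [mul_pow, inv_pow, hξ.pow_eq_one, inv_one, one_mul, hw]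
    · intro w _
      rw [mul_pow]
  have h1 : ξ ^ c ≠ 1 := fun h => hc ((hξ.pow_eq_one_iff_dvd c).1 h)
  have h2 : (ξ ^ c - 1) * ∑ w ∈ (Polynomial.nthRoots p u).toFinset, w ^ c = 0 := by
    rw [sub_mul, h, one_mul, sub_self]
  exact (mul_eq_zero.1 h2).resolve_left (sub_ne_zero.2 h1)

theorem isPrimitiveRoot_of_pow_of_dvd {p n : ℕ} (hp : p.Prime) {w : ℂ}
    (hw : IsPrimitiveRoot (w ^ p) n) (h : p ∣ orderOf w) : IsPrimitiveRoot w (n * p) := by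
  have h1 := hw.eq_orderOf
  rw [orderOf_pow_of_dvd hp.ne_zero h] at h1
  have := IsPrimitiveRoot.orderOf w
  rwa [← Nat.div_mul_cancel h, ← h1] at this

/-- The `p`-th roots of a primitive `n`-th root of unity are primitive of order `n * p`, unless
they are of order `n`, which happens only for `p` prime to `n`. -/
theorem isPrimitiveRoot_of_pow {p n : ℕ} (hp : p.Prime) {w : ℂ}
    (hw : IsPrimitiveRoot (w ^ p) n) (h : p ∣ n ∨ w ^ n ≠ 1) : IsPrimitiveRoot w (n * p) := by
  refine isPrimitiveRoot_of_pow_of_dvd hp hw ?_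
  -- If p does not divide the order of w, then w and w^p have the same order n; this contradicts
  -- either alternative.
  by_contra hd
  have hc : (orderOf w).Coprime p := ((Nat.Prime.coprime_iff_not_dvd hp).2 hd).symm
  have h1 := hw.eq_orderOf
  rw [hc.orderOf_pow] at h1
  rcases h with h | h
  · exact hd (h1 ▸ h)
  · exact h (h1 ▸ pow_orderOf_eq_one w)

-- Here all p-th roots of u have order np, so the sum runs over all of them. Only the linear term of
-- the p-factor varies with w, and its sum vanishes; the other terms are p equal copies carrying the
-- factor 1/p.
open Classical in
theorem normalGen_trace_prime_of_dvd {p n : ℕ} (hp : p.Prime) (hn : 0 < n) (hpn : p ∣ n) {u : ℂ}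
    (hu : IsPrimitiveRoot u n) :
    ∑ w ∈ (primitiveRoots (n * p) ℂ).filter (fun w => w ^ p = u), normalGen (n * p) w =
      normalGen n u := by
  have hF : (primitiveRoots (n * p) ℂ).filter (fun w => w ^ p = u) =
      (Polynomial.nthRoots p u).toFinset := by
    ext w
    rw [Finset.mem_filter, mem_toFinset_nthRoots hp,
      mem_primitiveRoots (Nat.mul_pos hn hp.pos)]
    exact ⟨fun h => h.2, fun h => ⟨isPrimitiveRoot_of_pow hp (h ▸ hu) (Or.inl hpn), h⟩⟩
  rw [hF]
  obtain ⟨k, n', hn', rfl⟩ := Nat.exists_eq_pow_mul_and_not_dvd hn.ne' p hp.ne_one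
  obtain ⟨k, rfl⟩ : ∃ j, k = j + 1 := by
    refine Nat.exists_eq_succ_of_ne_zero ?_
    rintro rfl
    simp [hn'] at hpn
  have hc : ∀ j, (p ^ j).Coprime n' := fun j =>
    Nat.Coprime.pow_left _ ((Nat.Prime.coprime_iff_not_dvd hp).2 hn')
  have e : p ^ (k + 1) * n' * p = p ^ (k + 2) * n' := by ring
  have hp0 : (p : ℂ) ≠ 0 := by exact_mod_cast hp.ne_zero
  -- The factor prime to p and the tail of the recursion involve w only through w^p = u.
  have hsum : ∀ w ∈ (Polynomial.nthRoots p u).toFinset, normalGen (p ^ (k + 1) * n' * p) w =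
      ((-1 / (p : ℚ) ^ (k + 1)) • w ^ n' + (1 / (p : ℚ)) • primePart p (k + 1) (u ^ n')) *
        normalGen n' (u ^ p ^ (k + 1)) := by
    intro w hw
    rw [mem_toFinset_nthRoots hp] at hw
    rw [e, normalGen_mul (hc _), normalGen_prime_pow hp, primePart_add_two hp.ne_zero, ← hw,
      ← pow_mul w p, ← pow_mul w p, ← pow_mul w n', mul_comm n' p, ← pow_succ']
  rw [Finset.sum_congr rfl hsum, ← Finset.sum_mul, Finset.sum_add_distrib, ← Finset.smul_sum,
    sum_nthRoots_pow hp u hn', smul_zero, zero_add, Finset.sum_const,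
    card_nthRoots_toFinset hp (hu.ne_zero hn.ne'), normalGen_mul (hc _), normalGen_prime_pow hp]
  congr 1
  rw [← Nat.cast_smul_eq_nsmul ℚ, smul_smul, mul_one_div_cancel (by exact_mod_cast hp.ne_zero),
    one_smul]

-- Exactly one p-th root of u has order n; the others have order np. On the latter the p-factor is
-- -w^n, and since w^n sums to 0 over all p-th roots with the exceptional one contributing 1, the
-- values -w^n sum to 1.
open Classical in
theorem normalGen_trace_prime_of_not_dvd {p n : ℕ} (hp : p.Prime) (hn : 0 < n) (hpn : ¬ p ∣ n)
    {u : ℂ} (hu : IsPrimitiveRoot u n) :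
    ∑ w ∈ (primitiveRoots (n * p) ℂ).filter (fun w => w ^ p = u), normalGen (n * p) w =
      normalGen n u := by
  have hF : (primitiveRoots (n * p) ℂ).filter (fun w => w ^ p = u) =
      (Polynomial.nthRoots p u).toFinset.filter (fun w => ¬ w ^ n = 1) := by
    ext w
    rw [Finset.mem_filter, Finset.mem_filter, mem_toFinset_nthRoots hp,
      mem_primitiveRoots (Nat.mul_pos hn hp.pos), and_comm]
    refine and_congr_right fun h => ⟨fun h' h1 => ?_, fun h' =>
      isPrimitiveRoot_of_pow hp (h ▸ hu) (Or.inr h')⟩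
    have := Nat.le_of_dvd hn (h'.dvd_of_pow_eq_one n h1)
    nlinarith [hp.two_le]
  have hc : n.Coprime p := ((Nat.Prime.coprime_iff_not_dvd hp).2 hpn).symm
  obtain ⟨a, -, ha, -, -⟩ := exists_add_modEq hc
  have hx : (u ^ a) ^ p = u := by
    rw [← pow_mul, pow_eq_pow_of_modEq ha hu.pow_eq_one, pow_one]
  -- The exponent a inverts p modulo n. The quotient of two such roots is killed by both n and p,
  -- hence by their gcd 1.
  have hone : (Polynomial.nthRoots p u).toFinset.filter (fun w => w ^ n = 1) = {u ^ a} := by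
    ext w
    rw [Finset.mem_filter, mem_toFinset_nthRoots hp, Finset.mem_singleton]
    constructor
    · rintro ⟨h1, h2⟩
      have hu0 : u ^ a ≠ 0 := pow_ne_zero _ (hu.ne_zero hn.ne')
      refine eq_of_div_eq_one ?_
      have h3 : (w / u ^ a) ^ n.gcd p = 1 := by
        refine pow_gcd_eq_one.2 ⟨?_, ?_⟩
        · rw [div_pow, h2, ← pow_mul, mul_comm, pow_mul, hu.pow_eq_one, one_pow, div_one]
        · rw [div_pow, h1, hx, div_self (hu.ne_zero hn.ne')]
      rwa [hc.gcd_eq_one, pow_one] at h3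
    · rintro rfl
      refine ⟨hx, ?_⟩
      rw [← pow_mul, mul_comm, pow_mul, hu.pow_eq_one, one_pow]
  have hs := sum_nthRoots_pow hp u hpn
  rw [← Finset.sum_filter_add_sum_filter_not _ (fun w => w ^ n = 1)] at hs
  rw [Finset.sum_congr rfl (g := fun _ => (1 : ℂ)) (by simp), hone] at hs
  rw [hF, Finset.sum_congr rfl (g := fun w => -w ^ n * normalGen n u), ← Finset.sum_mul,
    Finset.sum_neg_distrib]
  · rw [Finset.sum_singleton] at hs
    rw [neg_eq_of_add_eq_zero_left hs, one_mul]
  · intro w hw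
    rw [Finset.mem_filter, mem_toFinset_nthRoots hp] at hw
    rw [mul_comm n p, normalGen_mul hc.symm, hw.1]
    congr 1
    have := normalGen_prime_pow hp 0 (w ^ n)
    rwa [zero_add, pow_one, primePart_one] at this

open Classical in
/-- The trace of a normal generator is the normal generator of the subfield. -/
theorem normalGen_trace (d : ℕ) (hd : d ≠ 0) : ∀ {n : ℕ}, 0 < n → ∀ {u : ℂ},
    IsPrimitiveRoot u n →
    ∑ w ∈ (primitiveRoots (n * d) ℂ).filter (fun w => w ^ d = u), normalGen (n * d) w =
      normalGen n u := by
  induction d using Nat.recOnMul with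
  | zero => exact absurd rfl hd
  | one =>
    intro n hn u hu
    have : (primitiveRoots (n * 1) ℂ).filter (fun w => w ^ 1 = u) = {u} := by
      ext w
      rw [Finset.mem_filter, mem_primitiveRoots (by simpa using hn), Finset.mem_singleton]
      simp only [pow_one, mul_one]
      exact ⟨fun h => h.2, fun h => ⟨h ▸ hu, h⟩⟩
    rw [this, Finset.sum_singleton, mul_one]
  | prime p hp =>
    intro n hn u hu
    by_cases h : p ∣ n
    · exact normalGen_trace_prime_of_dvd hp hn h hu
    · exact normalGen_trace_prime_of_not_dvd hp hn h hu
  | mul a b ha hb =>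
    intro n hn u hu
    have ha0 : a ≠ 0 := left_ne_zero_of_mul hd
    have hb0 : b ≠ 0 := right_ne_zero_of_mul hd
    have hna : 0 < n * a := Nat.mul_pos hn (Nat.pos_of_ne_zero ha0)
    have hnab : 0 < n * a * b := Nat.mul_pos hna (Nat.pos_of_ne_zero hb0)
    rw [← ha ha0 hn hu]
    rw [← mul_assoc]
    -- Transitivity of the trace: the ab-th roots w of u are grouped by w^b, which is an a-th root
    -- of u.
    rw [← Finset.sum_fiberwise_of_maps_to (g := fun w => w ^ b)
      (t := (primitiveRoots (n * a) ℂ).filter (fun w => w ^ a = u))]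
    · refine Finset.sum_congr rfl fun v hv => ?_
      rw [Finset.mem_filter, mem_primitiveRoots hna] at hv
      rw [← hb hb0 hna hv.1, Finset.filter_filter]
      refine Finset.sum_congr ?_ fun _ _ => rfl
      refine Finset.filter_congr fun w _ => ⟨fun h => h.2, fun h => ⟨?_, h⟩⟩
      rw [mul_comm, pow_mul, h, hv.2]
    · intro w hw
      rw [Finset.mem_filter, mem_primitiveRoots hnab] at hw
      rw [Finset.mem_filter, mem_primitiveRoots hna, ← pow_mul, mul_comm b a]
      exact ⟨hw.1.pow hnab (mul_comm _ _), hw.2⟩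

end Trace

/-! ### Spanning by the conjugates of the normal generator -/

/-- The rational span of the conjugates of the normal generator. -/
def normalSpan (n : ℕ) : Submodule ℚ ℂ :=
  Submodule.span ℚ ((fun w => normalGen n w) '' {w | IsPrimitiveRoot w n})

theorem normalGen_mem_normalSpan {n : ℕ} {w : ℂ} (h : IsPrimitiveRoot w n) :
    normalGen n w ∈ normalSpan n := Submodule.subset_span ⟨w, h, rfl⟩

/-- The trace formula writes each generator of level n as a sum of generators of level nd. -/
theorem normalSpan_le_mul {n d : ℕ} (hn : 0 < n) (hd : 0 < d) :
    normalSpan n ≤ normalSpan (n * d) := by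
  classical
  refine Submodule.span_le.2 ?_
  rintro _ ⟨u, hu, rfl⟩
  change normalGen n u ∈ normalSpan (n * d)
  rw [← normalGen_trace d hd.ne' hn hu]
  refine Submodule.sum_mem _ fun w hw => normalGen_mem_normalSpan ?_
  rw [Finset.mem_filter, mem_primitiveRoots (Nat.mul_pos hn hd)] at hw
  exact hw.1

/-- Roots that are not primitive come from the previous level. For primitive z the recursion
exhibits the generator as a nonzero multiple of z plus a multiple of the generator at z^p, which
lies in the span of the previous level. -/
theorem mem_normalSpan_prime_pow {p : ℕ} (hp : p.Prime) (k : ℕ) :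
    ∀ z : ℂ, z ^ p ^ k = 1 → z ∈ normalSpan (p ^ k) := by
  have hp0 : (p : ℚ) ≠ 0 := by exact_mod_cast hp.ne_zero
  induction k with
  | zero =>
    intro z hz
    have h1 : IsPrimitiveRoot (1 : ℂ) 1 := IsPrimitiveRoot.one
    have := normalGen_mem_normalSpan h1
    rw [pow_zero, pow_one] at hz
    simpa [hz] using this
  | succ k ih =>
    intro z hz
    have hle : normalSpan (p ^ k) ≤ normalSpan (p ^ (k + 1)) := by
      rw [pow_succ]
      exact normalSpan_le_mul (pow_pos hp.pos k) hp.pos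
    by_cases h : z ^ p ^ k = 1
    · exact hle (ih z h)
    have hz' : IsPrimitiveRoot z (p ^ (k + 1)) := by
      have := orderOf_eq_prime_pow h hz (hp := ⟨hp⟩)
      rw [← this]
      exact IsPrimitiveRoot.orderOf z
    have hm := normalGen_mem_normalSpan hz'
    rw [normalGen_prime_pow hp] at hm
    -- At order p the generator is -z itself; the recursion starts only at p^2.
    cases k with
    | zero =>
      rw [zero_add, primePart_one] at hm
      simpa using hm
    | succ k =>
      rw [primePart_add_two hp.ne_zero] at hm
      have hzp : IsPrimitiveRoot (z ^ p) (p ^ (k + 1)) :=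
        hz'.pow (pow_pos hp.pos _) (pow_succ' _ _)
      have h2 := hle (normalGen_mem_normalSpan hzp)
      rw [normalGen_prime_pow hp] at h2
      have h3 := (Submodule.add_mem_iff_left _ (Submodule.smul_mem _ (1 / (p : ℚ)) h2)).1 hm
      refine (Submodule.smul_mem_iff _ ?_).1 h3
      exact div_ne_zero (by norm_num) (pow_ne_zero _ hp0)

/-- Primitive roots w and w' of coprime orders m and n are the n-th and m-th powers of a single
primitive mn-th root, so multiplicativity turns the product of their generators into one generator.
-/
theorem normalSpan_mul_le {m n : ℕ} (h : m.Coprime n) :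
    normalSpan m * normalSpan n ≤ normalSpan (m * n) := by
  rw [normalSpan, normalSpan, Submodule.span_mul_span, Submodule.span_le]
  rintro _ ⟨_, ⟨w, hw, rfl⟩, _, ⟨w', hw', rfl⟩, rfl⟩
  obtain ⟨a, b, ha, hb, -⟩ := exists_add_modEq h
  have h1 : (w ^ a * w' ^ b) ^ n = w := by
    rw [mul_pow, ← pow_mul, ← pow_mul, mul_comm b n, pow_mul w', hw'.pow_eq_one, one_pow, mul_one,
      pow_eq_pow_of_modEq ha hw.pow_eq_one, pow_one]
  have h2 : (w ^ a * w' ^ b) ^ m = w' := by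
    rw [mul_pow, ← pow_mul, ← pow_mul, mul_comm a m, pow_mul w, hw.pow_eq_one, one_pow, one_mul,
      pow_eq_pow_of_modEq hb hw'.pow_eq_one, pow_one]
  have hv : IsPrimitiveRoot (w ^ a * w' ^ b) (m * n) := by
    refine ⟨?_, fun l hl => h.mul_dvd_of_dvd_of_dvd ?_ ?_⟩
    · rw [mul_comm m n, pow_mul, h1, hw.pow_eq_one]
    · refine hw.dvd_of_pow_eq_one l ?_
      rw [← h1, ← pow_mul, mul_comm n l, pow_mul, hl, one_pow]
    · refine hw'.dvd_of_pow_eq_one l ?_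
      rw [← h2, ← pow_mul, mul_comm m l, pow_mul, hl, one_pow]
  have := normalGen_mem_normalSpan hv
  rwa [normalGen_mul h, h1, h2] at this

/-- The conjugates of the normal generator span the cyclotomic field. -/
theorem mem_normalSpan (n : ℕ) (hn : 0 < n) : ∀ z : ℂ, z ^ n = 1 → z ∈ normalSpan n := by
  induction n using Nat.recOnPosPrimePosCoprime with
  | prime_pow p k hp hk => exact mem_normalSpan_prime_pow hp k
  | zero => simp at hn
  | one => exact mem_normalSpan_prime_pow Nat.prime_two 0
  | coprime m n hm' hn' h ihm ihn =>
    intro z hz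
    have hm0 : 0 < m := by omega
    have hn0 : 0 < n := by omega
    obtain ⟨a, b, -, -, hab⟩ := exists_add_modEq h
    have : z = (z ^ n) ^ a * (z ^ m) ^ b := by
      rw [← pow_mul, ← pow_mul, ← pow_add, mul_comm n, mul_comm m, pow_eq_pow_of_modEq hab hz,
        pow_one]
    rw [this]
    refine normalSpan_mul_le h (Submodule.mul_mem_mul (ihm hm0 _ ?_) (ihn hn0 _ ?_))
    · rw [← pow_mul, ← pow_mul, show n * (a * m) = m * n * a by ring, pow_mul, hz, one_pow]
    · rw [← pow_mul, ← pow_mul, show m * (b * n) = m * n * b by ring, pow_mul, hz, one_pow]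

/-! ## One-dimensional representations and characters -/

section Characters

variable {G K : Type} [Group G] [Group K]

/-- The one-dimensional representation given by a character. -/
def charRep (χ : G →* ℂˣ) : FinRep G where
  V := ℂ
  ρ := (Algebra.lsmul ℂ ℂ ℂ : ℂ →ₐ[ℂ] Module.End ℂ ℂ).toMonoidHom.comp ((Units.coeHom ℂ).comp χ)

theorem charRep_apply (χ : G →* ℂˣ) (g : G) :
    (charRep χ).ρ g = (χ g : ℂ) • (LinearMap.id : ℂ →ₗ[ℂ] ℂ) := rfl

theorem taut_eq_charRep (n : ℕ+) : taut n = charRep (rootsOfUnity (n : ℕ) ℂ).subtype := rfl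

theorem res_charRep (α : K →* G) (χ : G →* ℂˣ) : (charRep χ).res α = charRep (χ.comp α) := rfl

theorem of_charRep_one : RU.of (charRep (1 : G →* ℂˣ)) = 1 := by
  have h : charRep (1 : G →* ℂˣ) ≈ FinRep.one G := by
    refine ⟨.mk (LinearEquiv.refl ℂ ℂ) fun g => LinearMap.ext fun (x : ℂ) => ?_⟩
    change (1 : ℂ) * x = x
    exact one_mul x
  rw [RU.of_eq h]
  rfl

theorem of_charRep_mul (χ ψ : G →* ℂˣ) :
    RU.of (charRep (χ * ψ)) = RU.of (charRep χ) * RU.of (charRep ψ) := by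
  rw [← RU.of_tensor]
  refine (RU.of_eq ⟨.mk (TensorProduct.lid ℂ ℂ) fun g => TensorProduct.ext' fun (x y : ℂ) => ?_⟩).symm
  change ((χ g : ℂ) * x) * ((ψ g : ℂ) * y) = ((χ g * ψ g : ℂˣ) : ℂ) * (x * y)
  push_cast
  ring

theorem of_charRep_pow (χ : G →* ℂˣ) (k : ℕ) :
    RU.of (charRep (χ ^ k)) = RU.of (charRep χ) ^ k := by
  induction k with
  | zero => rw [show χ ^ 0 = 1 from pow_zero χ, pow_zero, of_charRep_one]
  | succ k ih => rw [show χ ^ (k + 1) = χ ^ k * χ from pow_succ χ k, pow_succ, of_charRep_mul, ih]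

/-- The trace of the action of `g` on a representation. -/
def traceAt (g : G) : RepClass G → ℂ :=
  Quotient.lift (fun V : FinRep G => LinearMap.trace ℂ V.V (V.ρ g)) (by
    rintro V W ⟨e⟩
    have h : W.ρ g = e.toLinearEquiv.conj (V.ρ g) := by
      refine LinearMap.ext fun x => ?_
      obtain ⟨y, rfl⟩ := e.toLinearEquiv.surjective x
      rw [LinearEquiv.conj_apply_apply, LinearEquiv.symm_apply_apply]
      exact (e.toIntertwiningMap.isIntertwining _ _ g y).symm
    change LinearMap.trace ℂ V.V (V.ρ g) = LinearMap.trace ℂ W.V (W.ρ g)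
    rw [h, LinearMap.trace_conj'])

/-- The additive homomorphism sending a representation to the value of its character at `g`. -/
def RU.charAddHom (g : G) : RU G →+ ℂ :=
  RU.lift (traceAt g) fun V W => LinearMap.trace_prodMap' (V.ρ g) (W.ρ g)

theorem RU.charAddHom_of (g : G) (V : FinRep G) :
    RU.charAddHom g (RU.of V) = LinearMap.trace ℂ V.V (V.ρ g) := RU.lift_of _ _ V

/-- The value of characters at `g`, as a ring homomorphism on the representation ring. -/
def RU.charAt (g : G) : RU G →+* ℂ where
  __ := RU.charAddHom g
  map_one' := by
    change RU.charAddHom g 1 = 1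
    rw [← of_charRep_one, RU.charAddHom_of, charRep_apply]
    change LinearMap.trace ℂ ℂ _ = 1
    simp
  map_mul' := by
    intro x y
    change RU.charAddHom g (x * y) = RU.charAddHom g x * RU.charAddHom g y
    induction x using RU.induction with
    | hof V =>
      induction y using RU.induction with
      | hof W =>
        rw [← RU.of_tensor, RU.charAddHom_of, RU.charAddHom_of, RU.charAddHom_of]
        exact LinearMap.trace_tensorProduct' (V.ρ g) (W.ρ g)
      | hneg y h => rw [mul_neg, map_neg, h, map_neg, mul_neg]
      | hadd y z hy hz => rw [mul_add, map_add, hy, hz, map_add, mul_add]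
    | hneg x h => rw [neg_mul, map_neg, h, map_neg, neg_mul]
    | hadd x z hx hz => rw [add_mul, map_add, hx, hz, map_add, add_mul]

theorem RU.charAt_of (g : G) (V : FinRep G) :
    RU.charAt g (RU.of V) = LinearMap.trace ℂ V.V (V.ρ g) := RU.charAddHom_of g V

/-- The value of characters at `g` on the rationalized representation ring. -/
def RUQ.charAt (g : G) : RUQ G →ₐ[ℚ] ℂ :=
  Algebra.TensorProduct.lift (Algebra.ofId ℚ ℂ) (RU.charAt g).toIntAlgHom
    fun _ _ => Commute.all _ _

theorem RUQ.charAt_of (g : G) (V : FinRep G) :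
    RUQ.charAt g (RUQ.of V) = LinearMap.trace ℂ V.V (V.ρ g) := by
  have : RUQ.charAt g (RUQ.of V) = algebraMap ℚ ℂ 1 * RU.charAt g (RU.of V) := rfl
  rw [this, map_one, one_mul, RU.charAt_of]

theorem RUQ.charAt_charRep (g : G) (χ : G →* ℂˣ) :
    RUQ.charAt g (RUQ.of (charRep χ)) = χ g := by
  rw [RUQ.charAt_of, charRep_apply]
  change LinearMap.trace ℂ ℂ _ = _
  simp

theorem RUQ.res_of (α : K →* G) (V : FinRep G) : RUQ.res α (RUQ.of V) = RUQ.of (V.res α) := by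
  rw [RUQ.of, RUQ.res_tmul, RU.res_of, RUQ.of]

theorem RUQ.of_charRep_one : RUQ.of (charRep (1 : G →* ℂˣ)) = 1 := by
  rw [RUQ.of, GlobalRU.of_charRep_one]
  rfl

theorem RUQ.of_charRep_pow (χ : G →* ℂˣ) (k : ℕ) :
    RUQ.of (charRep (χ ^ k)) = RUQ.of (charRep χ) ^ k := by
  rw [RUQ.of, RUQ.of, GlobalRU.of_charRep_pow, Algebra.TensorProduct.tmul_pow, one_pow]

variable [Finite G]

/-- Transfers from `H` are annihilated by `[χ] - 1` for characters `χ` trivial on `H`. -/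
theorem RUQ.tr_mul_charRep (H : Subgroup G) (x : RUQ H) (χ : G →* ℂˣ) (hχ : ∀ h ∈ H, χ h = 1) :
    RUQ.tr H x * RUQ.of (charRep χ) = RUQ.tr H x := by
  have h : χ.comp H.subtype = 1 := MonoidHom.ext fun x => hχ x x.2
  rw [← RUQ.tr_mul_res, RUQ.res_of, res_charRep, h, RUQ.of_charRep_one, mul_one]

/-- By Frobenius reciprocity the transfer is unchanged by multiplication with χ, so its value at g
equals χ(g) times itself. -/
theorem RUQ.charAt_tr (H : Subgroup G) (x : RUQ H) (χ : G →* ℂˣ) (hχ : ∀ h ∈ H, χ h = 1) (g : G)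
    (hg : χ g ≠ 1) : RUQ.charAt g (RUQ.tr H x) = 0 := by
  have h := congrArg (RUQ.charAt g) (RUQ.tr_mul_charRep H x χ hχ)
  rw [map_mul, RUQ.charAt_charRep] at h
  by_contra h0
  exact hg (Units.ext (mul_left_cancel₀ h0 (h.trans (mul_one _).symm)))

end Characters

/-- Since G is abelian, h ∈ H acts trivially on the representation induced from the trivial one, so
the value is its dimension. -/
theorem charAt_tr_one_ne_zero {G : Type} [CommGroup G] [Finite G] (H : Subgroup G) {h : G}
    (hh : h ∈ H) : RUQ.charAt h (RUQ.tr H 1) ≠ 0 := by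
  have e : RUQ.tr H 1 = RUQ.of ((FinRep.one H).ind H) := by
    change RUQ.tr H (1 ⊗ₜ RU.of (FinRep.one H)) = _
    rw [RUQ.tr_tmul, RU.tr_of, RUQ.of]
  have hid : ((FinRep.one H).ind H).ρ h = LinearMap.id := by
    refine indMk_ext (φ := H.subtype) (ρ := (FinRep.one H).ρ) fun g a => ?_
    refine (ind_indMk H.subtype (FinRep.one H).ρ h g a).trans ?_
    have := indMk_mul H.subtype (FinRep.one H).ρ (⟨h, hh⟩⁻¹ : H) g a
    rw [mul_comm]
    exact this
  -- The augmentation g ⊗ a ↦ a is a nonzero functional on the induced space.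
  have hnt : Nontrivial ((FinRep.one H).ind H).V := by
    let f : ((FinRep.one H).ind H).V →ₗ[ℂ] ℂ :=
      indLift H.subtype (FinRep.one H).ρ (fun _ => LinearMap.id) (fun _ _ _ => rfl)
    have hf : f (indMk H.subtype (FinRep.one H).ρ 1 (1 : ℂ)) = 1 :=
      indLift_mk H.subtype (FinRep.one H).ρ (fun _ => LinearMap.id) (fun _ _ _ => rfl) 1 (1 : ℂ)
    refine ⟨indMk H.subtype (FinRep.one H).ρ 1 (1 : ℂ), 0, fun h0 => ?_⟩
    rw [h0, map_zero] at hf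
    exact zero_ne_one hf
  rw [e, RUQ.charAt_of, hid, LinearMap.trace_id]
  exact_mod_cast Module.finrank_pos.ne'

/-! ## Diagonal representations -/

section Diagonal

variable {G : Type} [Group G]

/-- The direct sum of a family of one-dimensional representations. -/
def diagRep {ι : Type} [Finite ι] (χ : ι → G →* ℂˣ) : FinRep G where
  V := ι → ℂ
  ρ :=
    { toFun g := LinearMap.pi fun i => (χ i g : ℂ) • LinearMap.proj i
      map_one' := by ext; simp
      map_mul' g h := LinearMap.ext fun v => funext fun i => by simp [mul_assoc] }

theorem diagRep_apply {ι : Type} [Finite ι] (χ : ι → G →* ℂˣ) (g : G) (v : ι → ℂ) (i : ι) :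
    (diagRep χ).ρ g v i = (χ i g : ℂ) * v i := rfl

theorem of_diagRep (d : ℕ) (χ : Fin d → G →* ℂˣ) :
    RU.of (diagRep χ) = ∑ i, RU.of (charRep (χ i)) := by
  induction d with
  | zero =>
    -- The class of the zero representation V is zero because V ⊕ V ≅ V gives 2[V] = [V].
    have h : (diagRep χ).sum (diagRep χ) ≈ diagRep χ := by
      refine ⟨.mk (LinearEquiv.ofLinearMap (LinearMap.fst ℂ _ _) 0 (LinearMap.ext fun x => ?_)
        (LinearMap.ext fun x => ?_)) fun g => LinearMap.ext fun x => ?_⟩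
      · exact funext fun i => i.elim0
      · exact Prod.ext (funext fun i => i.elim0) (funext fun i => i.elim0)
      · exact funext fun i => i.elim0
    have h2 := RU.of_eq h
    rw [RU.of_sum] at h2
    rw [Finset.univ_eq_empty, Finset.sum_empty]
    exact left_eq_add.1 h2.symm
  | succ d ih =>
    rw [Fin.sum_univ_succ, ← ih, ← RU.of_sum]
    refine RU.of_eq ⟨.mk (Fin.consLinearEquiv ℂ fun _ : Fin (d + 1) => ℂ).symm
      fun g => LinearMap.ext fun x => ?_⟩
    rfl

theorem equiv_diagRep {V : FinRep G} {ι : Type} [Finite ι] (b : Module.Basis ι ℂ V.V)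
    (χ : ι → G →* ℂˣ) (h : ∀ g i, V.ρ g (b i) = (χ i g : ℂ) • b i) : V ≈ diagRep χ := by
  classical
  refine ⟨.mk b.equivFun fun g => b.ext fun i => funext fun j => ?_⟩
  change b.equivFun (V.ρ g (b i)) j = (diagRep χ).ρ g (b.equivFun (b i)) j
  rw [diagRep_apply, h, map_smul, Pi.smul_apply, b.equivFun_self, smul_eq_mul]
  split_ifs with hij
  · rw [hij]
  · simp

end Diagonal

/-- The polynomial X^n - 1 is squarefree over ℂ, so f is semisimple: its generalized eigenspaces,
which exhaust V, are eigenspaces. -/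
theorem exists_eigenbasis {V : Type} [AddCommGroup V] [Module ℂ V] [Module.Finite ℂ V]
    (f : Module.End ℂ V) {n : ℕ} (hn : n ≠ 0) (hf : f ^ n = 1) :
    ∃ (d : ℕ) (b : Module.Basis (Fin d) ℂ V) (μ : Fin d → ℂ), ∀ i, f (b i) = μ i • b i := by
  have hsq : Squarefree (Polynomial.X ^ n - Polynomial.C (1 : ℂ)) :=
    (Polynomial.separable_X_pow_sub_C (1 : ℂ) (by exact_mod_cast hn) one_ne_zero).squarefree
  have hss : f.IsSemisimple :=
    Module.End.isSemisimple_of_squarefree_aeval_eq_zero hsq (by simp [hf])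
  have htop : ⨆ μ, f.eigenspace μ = ⊤ := by
    rw [← Module.End.iSup_maxGenEigenspace_eq_top f]
    exact iSup_congr fun μ => (hss.isFinitelySemisimple.maxGenEigenspace_eq_eigenspace μ).symm
  have hint := DirectSum.isInternal_submodule_of_iSupIndep_of_iSup_eq_top
    f.eigenspaces_iSupIndep htop
  let b := hint.collectedBasis fun μ => Module.finBasis ℂ (f.eigenspace μ)
  have : Finite (Σ μ : ℂ, Fin (Module.finrank ℂ (f.eigenspace μ))) := Module.Finite.finite_basis b
  obtain ⟨d, ⟨e⟩⟩ := Finite.exists_equiv_fin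
    (Σ μ : ℂ, Fin (Module.finrank ℂ (f.eigenspace μ)))
  refine ⟨d, b.reindex e, fun i => (e.symm i).1, fun i => ?_⟩
  rw [Module.Basis.reindex_apply]
  exact Module.End.mem_eigenspace_iff.1 (hint.collectedBasis_mem _ (e.symm i))

/-! ## The ring `τ(RU_ℚ)(C_n)` is a cyclotomic field -/

section Cyclotomic

open Polynomial

/-- The complex number `exp (2πi/n)`. -/
def expRoot (n : ℕ+) : ℂ := Complex.exp (2 * Real.pi * Complex.I / (n : ℕ))

theorem isPrimitiveRoot_expRoot (n : ℕ+) : IsPrimitiveRoot (expRoot n) (n : ℕ) :=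
  Complex.isPrimitiveRoot_exp n n.ne_zero

/-- The generator `exp (2πi/n)` of `C_n`. -/
def gen (n : ℕ+) : C n := (isPrimitiveRoot_expRoot n).toRootsOfUnity

theorem coe_gen (n : ℕ+) : ((gen n : ℂˣ) : ℂ) = expRoot n := rfl

theorem exists_gen_pow (n : ℕ+) (x : C n) : ∃ k : ℕ, x = gen n ^ k := by
  have hx : ((x : ℂˣ) : ℂ) ^ (n : ℕ) = 1 := by
    have := congrArg Units.val ((mem_rootsOfUnity _ _).1 x.2)
    rwa [Units.val_pow_eq_pow_val, Units.val_one] at this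
  obtain ⟨k, -, hk⟩ := (isPrimitiveRoot_expRoot n).eq_pow_of_pow_eq_one hx
  refine ⟨k, Subtype.ext (Units.ext ?_)⟩
  rw [← hk]
  simp [coe_gen]

theorem card_C (n : ℕ+) : Nat.card (C n) = n := Complex.card_rootsOfUnity n

/-- The class of the tautological representation in `RU_ℚ(C_n)`. -/
def tautQ (n : ℕ+) : RUQ (C n) := RUQ.of (taut n)

/-- The class of the tautological representation in `τ(RU_ℚ)(C_n)`. -/
def tautTau (n : ℕ+) : Tau (C n) := Tau.of (taut n)

theorem mk_aeval_tautQ (n : ℕ+) (P : ℚ[X]) :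
    Tau.mk (C n) (aeval (tautQ n) P) = aeval (tautTau n) P :=
  (aeval_algHom_apply (Tau.mk (C n)) (tautQ n) P).symm

theorem charAt_tautQ (n : ℕ+) (x : C n) : RUQ.charAt x (tautQ n) = ((x : ℂˣ) : ℂ) :=
  RUQ.charAt_charRep x (rootsOfUnity (n : ℕ) ℂ).subtype

theorem charAt_aeval_tautQ (n : ℕ+) (x : C n) (P : ℚ[X]) :
    RUQ.charAt x (aeval (tautQ n) P) = aeval ((x : ℂˣ) : ℂ) P := by
  rw [← aeval_algHom_apply, charAt_tautQ]

/-- Representations of `C_n` are sums of powers of the tautological one. -/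
theorem of_mem_adjoin_taut (n : ℕ+) (V : FinRep (C n)) :
    RU.of V ∈ Algebra.adjoin ℤ {RU.of (taut n)} := by
  have hg : gen n ^ (n : ℕ) = 1 := by
    refine Subtype.ext ?_
    exact (mem_rootsOfUnity _ _).1 (gen n).2
  have hf : V.ρ (gen n) ^ (n : ℕ) = 1 := by rw [← map_pow, hg, map_one]
  obtain ⟨d, b, μ, hb⟩ := exists_eigenbasis (V.ρ (gen n)) n.ne_zero hf
  have hpow : ∀ i (k : ℕ), V.ρ (gen n ^ k) (b i) = μ i ^ k • b i := by
    intro i k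
    induction k with
    | zero => simp
    | succ k ih => rw [pow_succ, map_mul, Module.End.mul_apply, hb, map_smul, ih, smul_smul,
        pow_succ, mul_comm]
  -- The eigenvalues of the generator are n-th roots of unity; their exponents name the powers of
  -- the tautological character that occur.
  have hμ : ∀ i, ∃ e : ℕ, expRoot n ^ e = μ i := by
    intro i
    have h1 := hpow i n
    rw [hg, map_one, Module.End.one_apply] at h1
    have h2 : (μ i ^ (n : ℕ) - 1) • b i = 0 := by rw [sub_smul, ← h1, one_smul, sub_self]
    have h3 := sub_eq_zero.1 ((smul_eq_zero.1 h2).resolve_right (b.ne_zero i))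
    obtain ⟨e, -, he⟩ := (isPrimitiveRoot_expRoot n).eq_pow_of_pow_eq_one h3
    exact ⟨e, he⟩
  choose e he using hμ
  have hV : V ≈ diagRep fun i => (rootsOfUnity (n : ℕ) ℂ).subtype ^ e i := by
    refine equiv_diagRep b _ fun g i => ?_
    obtain ⟨k, rfl⟩ := exists_gen_pow n g
    rw [hpow, ← he]
    congr 1
    change _ = (((gen n ^ k : C n) : ℂˣ) ^ e i : ℂˣ).val
    push_cast
    rw [coe_gen, ← pow_mul, ← pow_mul, mul_comm]
  rw [RU.of_eq hV, of_diagRep]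
  refine sum_mem fun i _ => ?_
  rw [of_charRep_pow]
  exact pow_mem (Algebra.self_mem_adjoin_singleton ℤ _) _

theorem mem_adjoin_taut (n : ℕ+) (x : RU (C n)) : x ∈ Algebra.adjoin ℤ {RU.of (taut n)} := by
  induction x using RU.induction with
  | hof V => exact of_mem_adjoin_taut n V
  | hneg x h => exact neg_mem h
  | hadd x y h h' => exact add_mem h h'

theorem aeval_tautQ_surjective (n : ℕ+) :
    Function.Surjective (aeval (tautQ n) : ℚ[X] →ₐ[ℚ] RUQ (C n)) := by
  intro x
  rw [← AlgHom.mem_range, ← Algebra.adjoin_singleton_eq_range_aeval]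
  induction x using TensorProduct.induction_on with
  | zero => exact zero_mem _
  | add x y hx hy => exact add_mem hx hy
  | tmul q x =>
    have hq : (q ⊗ₜ[ℤ] x : RUQ (C n)) = q • (1 ⊗ₜ[ℤ] x) := by
      rw [TensorProduct.smul_tmul', smul_eq_mul, mul_one]
    rw [hq]
    refine Subalgebra.smul_mem _ ?_ q
    clear hq
    induction mem_adjoin_taut n x using Algebra.adjoin_induction with
    | mem x hx =>
      rw [Set.mem_singleton_iff] at hx
      rw [hx]
      exact Algebra.self_mem_adjoin_singleton ℚ (tautQ n)
    | algebraMap r =>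
      have : (1 ⊗ₜ[ℤ] algebraMap ℤ (RU (C n)) r : RUQ (C n)) = r • 1 := by
        rw [Algebra.algebraMap_eq_smul_one, TensorProduct.tmul_smul]
        rfl
      rw [this]
      exact zsmul_mem (one_mem _) r
    | add x y _ _ hx hy => rw [TensorProduct.tmul_add]; exact add_mem hx hy
    | mul x y _ _ hx hy =>
      have : (1 ⊗ₜ[ℤ] (x * y) : RUQ (C n)) = (1 ⊗ₜ[ℤ] x) * (1 ⊗ₜ[ℤ] y) := by
        rw [Algebra.TensorProduct.tmul_mul_tmul, one_mul]
      rw [this]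
      exact mul_mem hx hy

theorem aeval_tautTau_surjective (n : ℕ+) :
    Function.Surjective (aeval (tautTau n) : ℚ[X] →ₐ[ℚ] Tau (C n)) := by
  intro x
  obtain ⟨x, rfl⟩ := Tau.mk_surjective _ x
  obtain ⟨P, rfl⟩ := aeval_tautQ_surjective n x
  exact ⟨P, (mk_aeval_tautQ n P).symm⟩

/-! ### Proper transfers and the cyclotomic relation -/

/-- For a proper subgroup H, the |H|-th power of the tautological character is trivial on H but not
at the generator, so transfers from H vanish there. -/
theorem charAt_gen_transferIdeal (n : ℕ+) (x : RUQ (C n)) (hx : x ∈ transferIdeal (C n)) :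
    RUQ.charAt (gen n) x = 0 := by
  rw [mem_transferIdeal] at hx
  induction hx using Submodule.iSup_induction' with
  | mem H x hx =>
    obtain ⟨z, rfl⟩ := hx
    refine RUQ.charAt_tr H.1 z ((rootsOfUnity (n : ℕ) ℂ).subtype ^ Nat.card H.1) ?_ _ ?_
    · intro h hh
      have : (⟨h, hh⟩ : H.1) ^ Nat.card H.1 = 1 := pow_card_eq_one'
      have h2 : h ^ Nat.card H.1 = 1 := congrArg Subtype.val this
      exact congrArg Subtype.val h2
    · intro h
      have h1 : expRoot n ^ Nat.card H.1 = 1 := by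
        have : ((gen n : C n) : ℂˣ) ^ Nat.card H.1 = 1 := h
        have := congrArg Units.val this
        rwa [Units.val_pow_eq_pow_val, Units.val_one] at this
      have h2 := (isPrimitiveRoot_expRoot n).dvd_of_pow_eq_one _ h1
      refine H.2 (Subgroup.eq_top_of_le_card _ ?_)
      rw [card_C]
      exact Nat.le_of_dvd Nat.card_pos h2
  | zero => simp
  | add a b _ _ ha hb => rw [map_add, ha, hb, add_zero]

/-- The embedding of `τ(RU_ℚ)(C_n)` into `ℂ` that evaluates characters at `exp (2πi/n)`. -/
def evalGen (n : ℕ+) : Tau (C n) →ₐ[ℚ] ℂ :=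
  Ideal.Quotient.liftₐ (transferIdeal (C n)) (RUQ.charAt (gen n)) (charAt_gen_transferIdeal n)

theorem evalGen_mk (n : ℕ+) (x : RUQ (C n)) :
    evalGen n (Tau.mk (C n) x) = RUQ.charAt (gen n) x := rfl

theorem evalGen_taut (n : ℕ+) : evalGen n (tautTau n) = expRoot n :=
  charAt_tautQ n (gen n)

instance (n : ℕ+) : Nontrivial (Tau (C n)) := (evalGen n).toRingHom.domain_nontrivial

theorem aeval_cyclotomic_eq_zero {K : Type*} [Field K] [Algebra ℚ K] {d : ℕ} (hd : 0 < d) {z : K}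
    (hz : IsPrimitiveRoot z d) : aeval z (cyclotomic d ℚ) = 0 := by
  have := hz.isRoot_cyclotomic hd
  rwa [IsRoot.def, ← map_cyclotomic d (algebraMap ℚ K), eval_map_algebraMap] at this

/-- The transfer of 1 from the subgroup of order d is a polynomial P in the tautological class. It
is zero in the quotient, yet its character is nonzero at an element of order d, so the irreducible
Φ_d does not divide P. A Bézout relation between Φ_d and P then inverts Φ_d. -/
theorem isUnit_aeval_cyclotomic (n : ℕ+) {d : ℕ} (hd : d ∈ (n : ℕ).properDivisors) :
    IsUnit (aeval (tautTau n) (cyclotomic d ℚ)) := by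
  rw [Nat.mem_properDivisors] at hd
  obtain ⟨⟨c, hc⟩, hlt⟩ := hd
  have hd0 : 0 < d := Nat.pos_of_ne_zero (by rintro rfl; simp at hc)
  have hroot : IsPrimitiveRoot (((gen n ^ c : C n) : ℂˣ) : ℂ) d := by
    have := (isPrimitiveRoot_expRoot n).pow n.pos (hc.trans (mul_comm _ _))
    simpa [coe_gen] using this
  set h : C n := gen n ^ c
  have hH : Subgroup.zpowers h ≠ ⊤ := by
    intro htop
    have h1 := Nat.card_zpowers h
    rw [htop, Subgroup.card_top, card_C] at h1
    have h2 : h ^ d = 1 := Subtype.ext (Units.ext (by simpa using hroot.pow_eq_one))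
    have := Nat.le_of_dvd hd0 (orderOf_dvd_of_pow_eq_one h2)
    omega
  obtain ⟨P, hP⟩ := aeval_tautQ_surjective n (RUQ.tr (Subgroup.zpowers h) 1)
  have hP0 : aeval (tautTau n) P = 0 := by
    rw [← mk_aeval_tautQ, hP, Tau.mk_eq_zero, mem_transferIdeal]
    exact Submodule.mem_iSup_of_mem ⟨_, hH⟩ ⟨1, rfl⟩
  have hne := charAt_tr_one_ne_zero (Subgroup.zpowers h) (Subgroup.mem_zpowers h)
  rw [← hP, charAt_aeval_tautQ] at hne
  have hcop : IsCoprime (cyclotomic d ℚ) P := by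
    rw [(cyclotomic.irreducible_rat hd0).coprime_iff_not_dvd]
    rintro ⟨Q, rfl⟩
    rw [map_mul, aeval_cyclotomic_eq_zero hd0 hroot, zero_mul] at hne
    exact hne rfl
  obtain ⟨a, b, hab⟩ := hcop
  have h1 := congrArg (aeval (tautTau n)) hab
  rw [map_add, map_mul, map_mul, hP0, mul_zero, add_zero, map_one] at h1
  exact IsUnit.of_mul_eq_one _ ((mul_comm _ _).trans h1)

theorem tautTau_pow (n : ℕ+) : tautTau n ^ (n : ℕ) = 1 := by
  have h1 : (rootsOfUnity (n : ℕ) ℂ).subtype ^ (n : ℕ) = 1 :=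
    MonoidHom.ext fun x => (mem_rootsOfUnity _ _).1 x.2
  have h2 : tautQ n ^ (n : ℕ) = 1 := by
    rw [tautQ, taut_eq_charRep, ← RUQ.of_charRep_pow, h1, RUQ.of_charRep_one]
  have := congrArg (Tau.mk (C n)) h2
  rwa [map_pow, map_one] at this

/-- The class is a root of X^n - 1 = ∏ Φ_d, in which every factor with d < n is a unit. -/
theorem aeval_tautTau_cyclotomic (n : ℕ+) : aeval (tautTau n) (cyclotomic n ℚ) = 0 := by
  have h := congrArg (aeval (tautTau n)) (prod_cyclotomic_eq_X_pow_sub_one n.pos ℚ)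
  rw [← Nat.insert_self_properDivisors n.ne_zero,
    Finset.prod_insert Nat.self_notMem_properDivisors, map_mul, map_prod, map_sub, map_pow,
    aeval_X, map_one, tautTau_pow, sub_self] at h
  have hu : IsUnit (∏ d ∈ (n : ℕ).properDivisors, aeval (tautTau n) (cyclotomic d ℚ)) :=
    IsUnit.prod_iff.2 fun d hd => isUnit_aeval_cyclotomic n hd
  exact hu.mul_left_eq_zero.1 h

/-- Irreducibility of Φ_n makes its ideal maximal, so the proper ideal containing it is equal to it.
No domain hypothesis on R is needed, so this applies to `Tau (C n)` before it is known to be a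
field. -/
theorem ker_aeval_eq_span_cyclotomic {R : Type*} [CommRing R] [Algebra ℚ R] [Nontrivial R] {n : ℕ}
    (hn : 0 < n) {z : R} (hz : aeval z (cyclotomic n ℚ) = 0) :
    RingHom.ker (aeval z : ℚ[X] →ₐ[ℚ] R) = Ideal.span {cyclotomic n ℚ} := by
  have hmax : (Ideal.span {cyclotomic n ℚ}).IsMaximal :=
    PrincipalIdealRing.isMaximal_of_irreducible (cyclotomic.irreducible_rat hn)
  refine (hmax.eq_of_le (RingHom.ker_ne_top _) ?_).symm
  rw [Ideal.span_singleton_le_iff_mem]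
  exact hz

/-- `τ(RU_ℚ)(C_n)` is isomorphic to the `n`-th cyclotomic field, with the tautological
representation going to a prescribed primitive root of unity. -/
theorem exists_tau_algEquiv (n : ℕ+) {L : Type*} [Field L] [Algebra ℚ L]
    [IsCyclotomicExtension {(n : ℕ)} ℚ L] {ζ : L} (hζ : IsPrimitiveRoot ζ (n : ℕ)) :
    ∃ e : Tau (C n) ≃ₐ[ℚ] L, e (tautTau n) = ζ := by
  have hs : Function.Surjective (aeval ζ : ℚ[X] →ₐ[ℚ] L) := by
    intro x
    rw [← AlgHom.mem_range, ← Algebra.adjoin_singleton_eq_range_aeval,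
      IsCyclotomicExtension.adjoin_primitive_root_eq_top hζ]
    exact Algebra.mem_top
  have hker : RingHom.ker (aeval (tautTau n) : ℚ[X] →ₐ[ℚ] Tau (C n)) =
      RingHom.ker (aeval ζ : ℚ[X] →ₐ[ℚ] L) := by
    rw [ker_aeval_eq_span_cyclotomic n.pos (aeval_tautTau_cyclotomic n),
      ker_aeval_eq_span_cyclotomic n.pos (aeval_cyclotomic_eq_zero n.pos hζ)]
  let e1 := Ideal.quotientKerAlgEquivOfSurjective (aeval_tautTau_surjective n)
  let e2 := Ideal.quotientKerAlgEquivOfSurjective hs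
  refine ⟨e1.symm.trans ((Ideal.quotientEquivAlgOfEq ℚ hker).trans e2), ?_⟩
  have h1 : e1 (Ideal.Quotient.mk _ X) = tautTau n := aeval_X _
  rw [AlgEquiv.trans_apply, (e1.symm_apply_eq).2 h1.symm]
  exact aeval_X ζ

/-- The tautological class and `expRoot n` satisfy the same polynomial relations, namely the
multiples of Φ_n. Identities in `Tau (C n)` can thus be checked in ℂ. -/
theorem evalGen_injective (n : ℕ+) : Function.Injective (evalGen n) := by
  rw [injective_iff_map_eq_zero]
  intro x hx
  obtain ⟨P, rfl⟩ := aeval_tautTau_surjective n x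
  have h : P ∈ RingHom.ker (aeval (expRoot n) : ℚ[X] →ₐ[ℚ] ℂ) := by
    rwa [← aeval_algHom_apply, evalGen_taut] at hx
  rw [ker_aeval_eq_span_cyclotomic n.pos
    (aeval_cyclotomic_eq_zero n.pos (isPrimitiveRoot_expRoot n)),
    ← ker_aeval_eq_span_cyclotomic n.pos (aeval_tautTau_cyclotomic n)] at h
  exact h

theorem finrank_tau (n : ℕ+) : Module.finrank ℚ (Tau (C n)) = Nat.totient n := by
  have : IsCyclotomicExtension {(n : ℕ)} ℚ (CyclotomicField n ℚ) :=
    CyclotomicField.isCyclotomicExtension n ℚ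
  obtain ⟨e, -⟩ := exists_tau_algEquiv n
    (IsCyclotomicExtension.zeta_spec (n : ℕ) ℚ (CyclotomicField n ℚ))
  rw [e.toLinearEquiv.finrank_eq]
  exact IsCyclotomicExtension.finrank _ (cyclotomic.irreducible_rat n.pos)

end Cyclotomic

/-! ## Morphisms of `Out_cyc` and primitive roots of unity -/

/-- The homomorphism underlying a morphism of `Out_cyc`. -/
def outHom {m n : ℕ+} (f : OutCyc.of m ⟶ OutCyc.of n) : C m →* C n :=
  (outCyc_hom_eq_mk f).choose

theorem outHom_surjective {m n : ℕ+} (f : OutCyc.of m ⟶ OutCyc.of n) :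
    Function.Surjective (outHom f) := (outCyc_hom_eq_mk f).choose_spec.choose

theorem homMk_outHom {m n : ℕ+} (f : OutCyc.of m ⟶ OutCyc.of n) :
    InducedCategory.homMk (Out.homMk (outHom f) (outHom_surjective f)) = f :=
  (outCyc_hom_eq_mk f).choose_spec.choose_spec.symm

theorem outHom_homMk {m n : ℕ+} (α : C m →* C n) (hα : Function.Surjective α) :
    outHom (InducedCategory.homMk (Out.homMk α hα) : OutCyc.of m ⟶ OutCyc.of n) = α :=
  outCyc_homMk_inj (homMk_outHom _)

theorem outHom_comp {l m n : ℕ+} (f : OutCyc.of l ⟶ OutCyc.of m) (g : OutCyc.of m ⟶ OutCyc.of n) :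
    outHom (f ≫ g) = (outHom g).comp (outHom f) := by
  have h : f ≫ g = InducedCategory.homMk (Out.homMk ((outHom g).comp (outHom f))
      ((outHom_surjective g).comp (outHom_surjective f))) := by
    conv_lhs => rw [← homMk_outHom f, ← homMk_outHom g]
    rfl
  rw [h, outHom_homMk]

/-- The image of the generator `exp (2πi/m)` under a morphism `C_m → C_n`. -/
def rootOf {m n : ℕ+} (f : OutCyc.of m ⟶ OutCyc.of n) : ℂ := ((outHom f (gen m) : C n) : ℂˣ)

/-- A homomorphism from a cyclic group is determined by the image of a generator, and conjugation in
the abelian target is trivial. -/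
theorem rootOf_injective {m n : ℕ+} :
    Function.Injective (rootOf : (OutCyc.of m ⟶ OutCyc.of n) → ℂ) := by
  intro f g h
  have h1 : outHom f (gen m) = outHom g (gen m) := Subtype.ext (Units.ext h)
  rw [← homMk_outHom f, ← homMk_outHom g]
  congr 2
  refine MonoidHom.ext fun x => ?_
  obtain ⟨k, rfl⟩ := exists_gen_pow m x
  rw [map_pow, map_pow, h1]

theorem coe_pow_C {n : ℕ+} (x : C n) (k : ℕ) :
    (((x ^ k : C n) : ℂˣ) : ℂ) = ((x : ℂˣ) : ℂ) ^ k := by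
  rw [Subgroup.coe_pow, Units.val_pow_eq_pow_val]

theorem coe_pow_card_C {n : ℕ+} (x : C n) : ((x : ℂˣ) : ℂ) ^ (n : ℕ) = 1 := by
  have := congrArg Units.val ((mem_rootsOfUnity _ _).1 x.2)
  rwa [Units.val_pow_eq_pow_val, Units.val_one] at this

theorem isPrimitiveRoot_rootOf {m n : ℕ+} (f : OutCyc.of m ⟶ OutCyc.of n) :
    IsPrimitiveRoot (rootOf f) (n : ℕ) := by
  refine ⟨coe_pow_card_C _, fun l hl => ?_⟩
  refine (isPrimitiveRoot_expRoot n).dvd_of_pow_eq_one l ?_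
  obtain ⟨x, hx⟩ := outHom_surjective f (gen n)
  obtain ⟨k, rfl⟩ := exists_gen_pow m x
  rw [← coe_gen, ← hx, map_pow, coe_pow_C, ← pow_mul, mul_comm, pow_mul]
  change rootOf f ^ l = 1 at hl
  change (rootOf f ^ l) ^ k = 1
  rw [hl, one_pow]

theorem exists_aut_rootOf_eq {n : ℕ+} {z : ℂ} (hz : IsPrimitiveRoot z (n : ℕ)) :
    ∃ j : Aut (OutCyc.of n), rootOf j.hom = z := by
  obtain ⟨k, -, hk⟩ := (isPrimitiveRoot_expRoot n).eq_pow_of_pow_eq_one hz.pow_eq_one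
  have hs : Function.Surjective (powMonoidHom k : C n →* C n) := by
    intro x
    obtain ⟨e, -, he⟩ := hz.eq_pow_of_pow_eq_one (coe_pow_card_C x)
    refine ⟨gen n ^ e, Subtype.ext (Units.ext ?_)⟩
    rw [powMonoidHom_apply, coe_pow_C, coe_pow_C, coe_gen, ← he, ← hk, ← pow_mul, ← pow_mul,
      mul_comm]
  -- Comparing the k-th power map with the identity turns it into an automorphism.
  obtain ⟨j, hj, -⟩ := existsUnique_aut (𝟙 (OutCyc.of n))
    (InducedCategory.homMk (Out.homMk (powMonoidHom k) hs))
  refine ⟨j, ?_⟩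
  rw [(Category.id_comp j.hom).symm.trans hj, rootOf, outHom_homMk, powMonoidHom_apply, coe_pow_C,
    coe_gen, hk]

theorem rootOf_comp_projHom {l m n : ℕ+} (f : OutCyc.of l ⟶ OutCyc.of m) (h : (n : ℕ) ∣ m) :
    rootOf (f ≫ projHom h) = rootOf f ^ (m / n : ℕ) := by
  rw [rootOf, outHom_comp, projHom, outHom_homMk, MonoidHom.comp_apply, proj_coe,
    Units.val_pow_eq_pow_val, rootOf]

theorem card_aut (n : ℕ+) : Fintype.card (Aut (OutCyc.of n)) = Nat.totient n := by
  rw [← Complex.card_primitiveRoots, ← Finset.card_univ]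
  refine Finset.card_bij (fun j _ => rootOf j.hom) ?_ ?_ ?_
  · intro j _
    exact (mem_primitiveRoots n.pos).2 (isPrimitiveRoot_rootOf j.hom)
  · intro i _ j _ h
    exact Iso.ext (rootOf_injective h)
  · intro z hz
    obtain ⟨j, hj⟩ := exists_aut_rootOf_eq ((mem_primitiveRoots n.pos).1 hz)
    exact ⟨j, Finset.mem_univ _, hj⟩

/-! ## The isomorphism -/

/-- The generator `x_n` of `τ(RU_ℚ)(C_n)` as a module over `ℚ[Out(C_n)]`. -/
def tauGen (n : ℕ+) : Tau (C n) := normalGen n (tautTau n)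

theorem evalGen_res_taut {m n : ℕ+} (α : C m →* C n) (hα : Function.Surjective α) :
    evalGen m (Tau.res α hα (tautTau n)) = ((α (gen m) : ℂˣ) : ℂ) := by
  have h : Tau.res α hα (tautTau n) =
      Tau.mk (C m) (RUQ.of (charRep ((rootsOfUnity (n : ℕ) ℂ).subtype.comp α))) :=
    (Tau.res_mk α hα _).trans (congrArg _ (RUQ.res_of α (taut n)))
  rw [h, evalGen_mk, RUQ.charAt_charRep]
  rfl

theorem evalGen_res_tauGen {m n : ℕ+} (α : C m →* C n) (hα : Function.Surjective α) :
    evalGen m (Tau.res α hα (tauGen n)) = normalGen n ((α (gen m) : ℂˣ) : ℂ) := by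
  rw [tauGen, map_normalGen, map_normalGen, evalGen_res_taut]

theorem res_proj_taut {m n : ℕ+} (h : (n : ℕ) ∣ m) :
    Tau.res (proj h) (proj_surjective h) (tautTau n) = tautTau m ^ (m / n : ℕ) := by
  refine evalGen_injective m ?_
  rw [evalGen_res_taut, map_pow, evalGen_taut, proj_coe, Units.val_pow_eq_pow_val, coe_gen]

/-- The `Out(C_n)`-equivariant map `ℚ[Out(C_n)] → τ(RU_ℚ)(C_n)` classified by `tauGen n`. -/
def orbitMap (n : ℕ+) : (Aut (OutCyc.of n) →₀ ℚ) →ₗ[ℚ] Tau (C n) :=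
  Finsupp.linearCombination ℚ fun j => Tau.res (outHom j.hom) (outHom_surjective j.hom) (tauGen n)

theorem orbitMap_single (n : ℕ+) (j : Aut (OutCyc.of n)) :
    orbitMap n (Finsupp.single j 1) =
      Tau.res (outHom j.hom) (outHom_surjective j.hom) (tauGen n) := by
  simp [orbitMap]

theorem evalGen_orbitMap_single (n : ℕ+) (j : Aut (OutCyc.of n)) :
    evalGen n (orbitMap n (Finsupp.single j 1)) = normalGen n (rootOf j.hom) := by
  rw [orbitMap_single, evalGen_res_tauGen, rootOf]

theorem orbitMap_one (n : ℕ+) : orbitMap n (Finsupp.single 1 1) = tauGen n := by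
  have h : outHom (1 : Aut (OutCyc.of n)).hom = MonoidHom.id (C n) :=
    outHom_homMk (MonoidHom.id (C n)) Function.surjective_id
  refine evalGen_injective n ?_
  rw [evalGen_orbitMap_single, rootOf, h, tauGen, map_normalGen, evalGen_taut]
  rfl

/-- Via `rootOf`, the fiber becomes the set of primitive m-th roots of unity whose (m/n)-th power is
`rootOf (f ≫ j.hom)`, so this is the trace formula. -/
theorem sum_fiber_normalGen {m n : ℕ+} (f : OutCyc.of m ⟶ OutCyc.of n) (j : Aut (OutCyc.of n)) :
    ∑ j' ∈ fiber f j, normalGen m (rootOf j'.hom) = normalGen n (rootOf (f ≫ j.hom)) := by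
  classical
  have hd := dvd_of_hom f
  have h0 : (m / n : ℕ) ≠ 0 := (Nat.div_pos (Nat.le_of_dvd m.pos hd) n.pos).ne'
  rw [← normalGen_trace _ h0 n.pos (isPrimitiveRoot_rootOf (f ≫ j.hom)), Nat.mul_div_cancel' hd]
  refine Finset.sum_bij (fun j' _ => rootOf j'.hom) ?_ ?_ ?_ fun _ _ => rfl
  · intro j' hj'
    rw [mem_fiber] at hj'
    rw [Finset.mem_filter, mem_primitiveRoots m.pos, ← hj', rootOf_comp_projHom]
    exact ⟨isPrimitiveRoot_rootOf j'.hom, rfl⟩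
  · intro i _ j _ h
    exact Iso.ext (rootOf_injective h)
  · intro z hz
    rw [Finset.mem_filter, mem_primitiveRoots m.pos] at hz
    obtain ⟨j', rfl⟩ := exists_aut_rootOf_eq hz.1
    refine ⟨j', ?_, rfl⟩
    rw [mem_fiber]
    refine rootOf_injective ?_
    rw [rootOf_comp_projHom, hz.2]

/-- Naturality of the orbit maps; on basis elements, after evaluation in ℂ, it is the trace formula.
-/
theorem res_orbitMap {m n : ℕ+} (f : OutCyc.of m ⟶ OutCyc.of n) (x : Aut (OutCyc.of n) →₀ ℚ) :
    Tau.res (outHom f) (outHom_surjective f) (orbitMap n x) = orbitMap m (regMap f x) := by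
  suffices h : (Tau.res (outHom f) (outHom_surjective f)).toLinearMap ∘ₗ orbitMap n =
      orbitMap m ∘ₗ regMap f from LinearMap.congr_fun h x
  refine Finsupp.lhom_ext' fun j => LinearMap.ext_ring (evalGen_injective m ?_)
  change evalGen m (Tau.res (outHom f) (outHom_surjective f) (orbitMap n (Finsupp.single j 1))) =
    evalGen m (orbitMap m (regMap f (Finsupp.single j 1)))
  have hs : Function.Surjective ((outHom j.hom).comp (outHom f)) :=
    (outHom_surjective j.hom).comp (outHom_surjective f)
  have hc := Tau.res_comp (outHom j.hom) (outHom_surjective j.hom) (outHom f)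
    (outHom_surjective f) hs
  have hl := DFunLike.congr_fun hc (tauGen n)
  rw [AlgHom.comp_apply] at hl
  rw [orbitMap_single, hl, evalGen_res_tauGen, regMap_single, map_sum, map_sum]
  simp only [evalGen_orbitMap_single]
  rw [sum_fiber_normalGen, rootOf, outHom_comp]

/-- Powers of the tautological class span, their values are n-th roots of unity, and these lie in
the span of the conjugates of the generator. -/
theorem orbitMap_surjective (n : ℕ+) : Function.Surjective (orbitMap n) := by
  intro x
  have h1 : evalGen n x ∈ normalSpan n := by
    obtain ⟨P, rfl⟩ := aeval_tautTau_surjective n x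
    rw [← Polynomial.aeval_algHom_apply, evalGen_taut, Polynomial.aeval_eq_sum_range]
    refine sum_mem fun i _ => Submodule.smul_mem _ _ (mem_normalSpan n n.pos _ ?_)
    rw [← pow_mul, mul_comm, pow_mul, (isPrimitiveRoot_expRoot n).pow_eq_one, one_pow]
  have h2 : normalSpan n ≤ LinearMap.range ((evalGen n).toLinearMap ∘ₗ orbitMap n) := by
    refine Submodule.span_le.2 ?_
    rintro _ ⟨w, hw, rfl⟩
    obtain ⟨j, rfl⟩ := exists_aut_rootOf_eq hw
    exact ⟨Finsupp.single j 1, evalGen_orbitMap_single n j⟩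
  obtain ⟨y, hy⟩ := h2 h1
  exact ⟨y, evalGen_injective n hy⟩

/-- Both sides have dimension φ(n), so linear independence of the conjugates comes for free from
spanning. -/
theorem orbitMap_bijective (n : ℕ+) : Function.Bijective (orbitMap n) := by
  have hfin : Module.Finite ℚ (Tau (C n)) := Module.Finite.of_surjective _ (orbitMap_surjective n)
  have hrank : Module.finrank ℚ (Aut (OutCyc.of n) →₀ ℚ) = Module.finrank ℚ (Tau (C n)) := by
    rw [Module.finrank_finsupp_self, card_aut, finrank_tau]
  exact ⟨(LinearMap.injective_iff_surjective_of_finrank_eq_finrank hrank).2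
    (orbitMap_surjective n), orbitMap_surjective n⟩

/-- The isomorphism `ℚ[Out(-)] ≅ τ(RU_ℚ)` of `Out_cyc^op`-modules classified by the elements
`tauGen n`. -/
def regOutIsoTau : regOut ⋙ ModuleCat.uliftFunctor.{1} ℚ ≅ OutCyc.ι.op ⋙ tauRU :=
  NatIso.ofComponents
    (fun X => (ULift.moduleEquiv.trans
      (LinearEquiv.ofBijective (orbitMap X.unop) (orbitMap_bijective X.unop))).toModuleIso)
    (fun {X Y} f => by
      refine ModuleCat.hom_ext (LinearMap.ext fun x => ?_)
      obtain ⟨f, rfl⟩ : ∃ g : OutCyc.of Y.unop ⟶ OutCyc.of X.unop, f = g.op := ⟨f.unop, rfl⟩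
      have h := res_orbitMap f x.down
      -- The functor is defined on conjugacy classes; it is computed on the chosen representative
      -- `outHom f`.
      have hf : (OutCyc.ι.op ⋙ tauRU).map f.op =
          ModuleCat.ofHom (Tau.res (outHom f) (outHom_surjective f)).toLinearMap := by
        conv_lhs => rw [← homMk_outHom f]
        rfl
      rw [hf]
      exact h.symm)

theorem classifying_regOutIsoTau (n : ℕ+) : classifying regOutIsoTau.hom n = tauGen n :=
  orbitMap_one n

theorem tauGen_mul {m n : ℕ+} (h : Nat.Coprime m n) (hm : (m : ℕ) ∣ (m * n : ℕ+))
    (hn : (n : ℕ) ∣ (m * n : ℕ+)) : tauGen (m * n) =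
    Tau.res (proj hm) (proj_surjective hm) (tauGen m) *
      Tau.res (proj hn) (proj_surjective hn) (tauGen n) := by
  rw [tauGen, tauGen, tauGen, map_normalGen, map_normalGen, res_proj_taut, res_proj_taut,
    show ((m * n : ℕ+) / m : ℕ) = n from Nat.mul_div_cancel_left _ m.pos,
    show ((m * n : ℕ+) / n : ℕ) = m from Nat.mul_div_cancel _ n.pos]
  exact normalGen_mul h _

end GlobalRU

end

theorem proposition3p3 :
    ∃ φ : GlobalRU.regOut ⋙ ModuleCat.uliftFunctor.{1} ℚ ≅
        GlobalRU.OutCyc.ι.op ⋙ GlobalRU.tauRU,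
      GlobalRU.classifying φ.hom 1 = 1 ∧
      (∀ (p k : ℕ) (n : ℕ+), p.Prime → (n : ℕ) = p ^ (k + 1) →
        ∀ (L : Type) [Field L] [Algebra ℚ L] [IsCyclotomicExtension {(n : ℕ)} ℚ L] (ζ : L),
          IsPrimitiveRoot ζ n →
          ∃ e : GlobalRU.Tau (GlobalRU.C n) ≃ₐ[ℚ] L,
            e (GlobalRU.Tau.of (GlobalRU.taut n)) = ζ ∧
            e (GlobalRU.classifying φ.hom n) =
              (-1 / (p : ℚ) ^ k) • ∑ i ∈ Finset.range (k + 1), ζ ^ p ^ i) ∧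
      (∀ m n : ℕ+, Nat.Coprime m n →
        GlobalRU.classifying φ.hom (m * n) =
          GlobalRU.Tau.res (GlobalRU.proj (m := m * n) (n := m) (by simp))
              (GlobalRU.proj_surjective _) (GlobalRU.classifying φ.hom m) *
            GlobalRU.Tau.res (GlobalRU.proj (m := m * n) (n := n) (by simp))
              (GlobalRU.proj_surjective _) (GlobalRU.classifying φ.hom n)) := by
  refine ⟨GlobalRU.regOutIsoTau, ?_, ?_, ?_⟩
  · rw [GlobalRU.classifying_regOutIsoTau]
    exact GlobalRU.normalGen_one _
  · intro p k n hp hn L _ _ _ ζ hζ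
    obtain ⟨e, he⟩ := GlobalRU.exists_tau_algEquiv n hζ
    refine ⟨e, he, ?_⟩
    rw [GlobalRU.classifying_regOutIsoTau, GlobalRU.tauGen]
    -- The classifying element is a rational polynomial in the tautological class, so e carries it
    -- to the same expression in ζ.
    refine (GlobalRU.map_normalGen e.toAlgHom n (GlobalRU.tautTau n)).trans ?_
    change GlobalRU.normalGen n (e (GlobalRU.tautTau n)) = _
    rw [he, hn, GlobalRU.normalGen_prime_pow hp]
    rfl
  · intro m n h
    simp only [GlobalRU.classifying_regOutIsoTau]
    exact GlobalRU.tauGen_mul h _ _
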